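/- Let $K$ be a field with a fixed involution $k\mapsto\overline{k}$ (possibly the identity). A directed graph $E=(E^0,E^1,r,s)$ consists of vertices $E^0$, edges $E^1$, and range and source maps $r,s\colon E^1\to E^0$; it is finite if $E^0$ and $E^1$ are finite. A cycle in $E$ is a sequence of edges $e_1\cdots e_n$ ($n\ge 1$) with $r(e_i)=s(e_{i+1})$ for $1\le i<n$, $r(e_n)=s(e_1)$, and $s(e_i)\ne s(e_j)$ for $i\neq j$; an exit of it is an edge $e$ such that $s(e)=s(e_i)$ and $e\ne e_i$ for some $i$. The graph $E$ is a no-exit graph if no cycle in $E$ has an exit. For a finite graph $E$, the Leavitt path algebra $L(E)=L_K(E)$ is the unital $K$-algebra with identity $1=\sum_{v\in E^0}v$ generated by symbols $v$ ($v\in E^0$), $e$ and $e^*$ ($e\in E^1$) subject to the relations $vv=v$ and $vw=0$ for distinct vertices $v,w$; $e=s(e)e=e\,r(e)$ and $e^*=r(e)e^*=e^*s(e)$; $e^*e=r(e)$ and $e^*f=0$ for distinct edges $e,f$; and $v=\sum_{e\in E^1,\,s(e)=v}ee^*$ for every vertex $v$ that emits at least one edge. It carries the conjugate-linear involution (anti-automorphism)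 that fixes every vertex and exchanges $e$ and $e^*$ for every edge $e$. **Theorem.** Let $E$ and $F$ be finite no-exit graphs. The following conditions are equivalent. 1. $L(E)\cong L(F)$ as rings. 2. $L(E)\cong L(F)$ as $K$-algebras. 3. $L(E)\cong L(F)$ as $^*$-algebras, that is, there is a $K$-algebra isomorphism $L(E)\to L(F)$ that commutes with the involutions. -/

import Mathlib

/-- A directed graph `(V, E, r, s)`: `V` is the type of vertices, `E` the type of edges, and
`source`, `range` give the source and the range of an edge. Loops and parallel edges are allowed. -/
structure DirectedGraph (V E : Type*) where
  source : E → V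
  range : E → V

namespace DirectedGraph

variable {V E : Type*} (G : DirectedGraph V E)

/-- A path of positive length `e₁ … eₙ`: a nonempty list of edges with
`s(eᵢ₊₁) = r(eᵢ)` for all `i < n`. -/
def IsPath (p : List E) : Prop :=
  p ≠ [] ∧ p.IsChain (fun e f => G.source f = G.range e)

/-- A cycle: a path `e₁ … eₙ` (with `n ≥ 1`) that is closed, `s(e₁) = r(eₙ)`, and such that
`s(eᵢ) ≠ s(eⱼ)` for `i ≠ j`. -/
def IsCycle (p : List E) : Prop :=
  G.IsPath p ∧ (∃ h : p ≠ [], G.source (p.head h) = G.range (p.getLast h)) ∧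
    (p.map G.source).Nodup

/-- An edge `e` is an exit of the path `e₁ … eₙ` if there is an `i` with `s(e) = s(eᵢ)` and
`e ≠ eᵢ`. -/
def IsExit (p : List E) (e : E) : Prop :=
  ∃ f ∈ p, G.source e = G.source f ∧ e ≠ f

/-- Condition (NE): no cycle has an exit. -/
def IsNoExit : Prop :=
  ∀ p : List E, G.IsCycle p → ∀ e : E, ¬ G.IsExit p e

end DirectedGraph

namespace Leavitt

/-- The generators of the Leavitt path algebra: vertices, edges and ghost edges. -/
inductive Gen (V E : Type*) where
  | vert : V → Gen V E
  | edge : E → Gen V E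
  | ghost : E → Gen V E

section

variable (K : Type*) [Field K] {V E : Type*}

/-- A vertex, in the free algebra on the generators. -/
noncomputable abbrev fVert (v : V) : FreeAlgebra K (Gen V E) := FreeAlgebra.ι K (Gen.vert v)

/-- An edge, in the free algebra on the generators. -/
noncomputable abbrev fEdge (e : E) : FreeAlgebra K (Gen V E) := FreeAlgebra.ι K (Gen.edge e)

/-- A ghost edge `e*`, in the free algebra on the generators. -/
noncomputable abbrev fGhost (e : E) : FreeAlgebra K (Gen V E) := FreeAlgebra.ι K (Gen.ghost e)

variable [Fintype V] [Fintype E]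

open Classical in
/-- The defining relations of the Leavitt path algebra of a finite graph, as a unital algebra. The
path algebra relations are imposed on the extended graph, where `s(e*) = r(e)` and
`r(e*) = s(e)`. Since there are finitely many vertices, the algebra is unital with identity the
sum of all vertices; this is the relation `one`. -/
inductive Rel (G : DirectedGraph V E) :
    FreeAlgebra K (Gen V E) → FreeAlgebra K (Gen V E) → Prop
  | vert_mul_self (v : V) : Rel G (fVert K v * fVert K v) (fVert K v)
  | vert_mul_of_ne (v w : V) (h : v ≠ w) : Rel G (fVert K v * fVert K w) 0
  | source_mul_edge (e : E) : Rel G (fVert K (G.source e) * fEdge K e) (fEdge K e)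
  | edge_mul_range (e : E) : Rel G (fEdge K e * fVert K (G.range e)) (fEdge K e)
  | range_mul_ghost (e : E) : Rel G (fVert K (G.range e) * fGhost K e) (fGhost K e)
  | ghost_mul_source (e : E) : Rel G (fGhost K e * fVert K (G.source e)) (fGhost K e)
  | ghost_mul_edge_self (e : E) : Rel G (fGhost K e * fEdge K e) (fVert K (G.range e))
  | ghost_mul_edge_of_ne (e f : E) (h : e ≠ f) : Rel G (fGhost K e * fEdge K f) 0
  | vert_eq_sum (v : V) (h : ∃ e, G.source e = v) :
      Rel G (fVert K v) (∑ e ∈ Finset.univ.filter (fun e => G.source e = v),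
        fEdge K e * fGhost K e)
  | one : Rel G 1 (∑ v : V, fVert K v)

end

end Leavitt

/-- The Leavitt path algebra `L_K(E)` of a finite graph over a field. -/
def LeavittPathAlgebra (K : Type*) [Field K] {V E : Type*} [Fintype V] [Fintype E]
    (G : DirectedGraph V E) : Type _ :=
  RingQuot (Leavitt.Rel K G)

namespace LeavittPathAlgebra

open Leavitt

section

variable (K : Type*) [Field K] {V E : Type*} [Fintype V] [Fintype E] (G : DirectedGraph V E)

noncomputable instance instRing : Ring (LeavittPathAlgebra K G) :=
  inferInstanceAs (Ring (RingQuot (Leavitt.Rel K G)))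

noncomputable instance instAlgebra : Algebra K (LeavittPathAlgebra K G) :=
  inferInstanceAs (Algebra K (RingQuot (Leavitt.Rel K G)))

/-- The quotient map from the free algebra. -/
noncomputable def mk : FreeAlgebra K (Gen V E) →ₐ[K] LeavittPathAlgebra K G :=
  RingQuot.mkAlgHom K (Leavitt.Rel K G)

/-- The image of a generator in the Leavitt path algebra. -/
noncomputable def gen (x : Gen V E) : LeavittPathAlgebra K G := mk K G (FreeAlgebra.ι K x)

variable {K G}

theorem mk_rel {x y : FreeAlgebra K (Gen V E)} (h : Rel K G x y) : mk K G x = mk K G y :=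
  RingQuot.mkAlgHom_rel K h

theorem mk_ι (x : Gen V E) : mk K G (FreeAlgebra.ι K x) = gen K G x := rfl

theorem ringHom_ext {A : Type*} [Semiring A] {f g : LeavittPathAlgebra K G →+* A}
    (h₁ : ∀ k : K, f (algebraMap K _ k) = g (algebraMap K _ k))
    (h₂ : ∀ x, f (gen K G x) = g (gen K G x)) : f = g := by
  apply RingHom.ext
  intro a
  obtain ⟨b, rfl⟩ : ∃ b, mk K G b = a := RingQuot.mkAlgHom_surjective K (Leavitt.Rel K G) a
  induction b using FreeAlgebra.induction with
  | grade0 k => simpa using h₁ k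
  | grade1 x => exact h₂ x
  | mul a b ha hb => simp only [map_mul, ha, hb]
  | add a b ha hb => simp only [map_add, ha, hb]

/-- The involution on generators: it fixes vertices and exchanges `e` and `e*`. -/
def genStar : Gen V E → Gen V E
  | .vert v => .vert v
  | .edge e => .ghost e
  | .ghost e => .edge e

end

section Star

variable (K : Type*) [Field K] [StarRing K] {V E : Type*} [Fintype V] [Fintype E]
  (G : DirectedGraph V E)

/-- The opposite ring of the Leavitt path algebra, with scalars acting through the involution of
`K`. The involution of `L_K(E)` is a homomorphism of `K`-algebras into it. -/
def Conj : Type _ := (LeavittPathAlgebra K G)ᵐᵒᵖ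

noncomputable instance : Ring (Conj K G) :=
  inferInstanceAs (Ring (LeavittPathAlgebra K G)ᵐᵒᵖ)

noncomputable instance : Algebra K (Conj K G) :=
  RingHom.toAlgebra' ((algebraMap K (LeavittPathAlgebra K G)ᵐᵒᵖ).comp (starRingEnd K))
    (fun k x => Algebra.commutes (A := (LeavittPathAlgebra K G)ᵐᵒᵖ) (starRingEnd K k) x)

/-- The identity map `L_K(E)ᵐᵒᵖ → Conj`. -/
noncomputable def toConj : (LeavittPathAlgebra K G)ᵐᵒᵖ ≃+* Conj K G := RingEquiv.refl _

theorem algebraMap_conj (k : K) : algebraMap K (Conj K G) k =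
    toConj K G (MulOpposite.op (algebraMap K (LeavittPathAlgebra K G) (star k))) := rfl

/-- The involution, on the free algebra. -/
noncomputable def preStar : FreeAlgebra K (Gen V E) →ₐ[K] Conj K G :=
  FreeAlgebra.lift K fun x => toConj K G (MulOpposite.op (gen K G (genStar x)))

theorem preStar_ι (x : Gen V E) : preStar K G (FreeAlgebra.ι K x) =
    toConj K G (MulOpposite.op (gen K G (genStar x))) := by
  simp [preStar]

theorem preStar_rel {x y : FreeAlgebra K (Gen V E)} (h : Rel K G x y) :
    preStar K G x = preStar K G y := by
  cases h <;>
    simp only [map_mul, map_sum, map_zero, map_one, fVert, fEdge, fGhost, preStar_ι, genStar] <;>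
    simp only [← map_mul, ← map_sum, ← MulOpposite.op_mul, ← Finset.op_sum] <;>
    simp only [← map_zero (toConj K G), ← map_one (toConj K G), ← MulOpposite.op_zero,
      ← MulOpposite.op_one, ← mk_ι] <;>
    refine congrArg (fun a => toConj K G (MulOpposite.op a)) ?_ <;>
    simp only [← map_mul, ← map_sum, ← map_zero (mk K G), ← map_one (mk K G)] <;>
    apply mk_rel
  case vert_mul_self v => exact .vert_mul_self v
  case vert_mul_of_ne v w h => exact .vert_mul_of_ne w v h.symm
  case source_mul_edge e => exact .ghost_mul_source e
  case edge_mul_range e => exact .range_mul_ghost e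
  case range_mul_ghost e => exact .edge_mul_range e
  case ghost_mul_source e => exact .source_mul_edge e
  case ghost_mul_edge_self e => exact .ghost_mul_edge_self e
  case ghost_mul_edge_of_ne e f h => exact .ghost_mul_edge_of_ne f e h.symm
  case vert_eq_sum v h => exact .vert_eq_sum v h
  case one => exact .one

/-- The involution, as a ring homomorphism into the opposite ring. -/
noncomputable def starHom : LeavittPathAlgebra K G →+* (LeavittPathAlgebra K G)ᵐᵒᵖ :=
  ((toConj K G).symm : Conj K G →+* (LeavittPathAlgebra K G)ᵐᵒᵖ).comp
    (RingQuot.liftAlgHom K ⟨preStar K G, fun _ _ h => preStar_rel K G h⟩ :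
      RingQuot (Leavitt.Rel K G) →ₐ[K] Conj K G).toRingHom

variable {K G}

theorem starHom_mk (x : FreeAlgebra K (Gen V E)) :
    starHom K G (mk K G x) = (toConj K G).symm (preStar K G x) :=
  congrArg (toConj K G).symm (RingQuot.liftAlgHom_mkAlgHom_apply _ _ _ x)

theorem starHom_gen (x : Gen V E) :
    starHom K G (gen K G x) = MulOpposite.op (gen K G (genStar x)) := by
  rw [← mk_ι, starHom_mk, preStar_ι, RingEquiv.symm_apply_apply]

theorem starHom_algebraMap (k : K) : starHom K G (algebraMap K _ k) =
    MulOpposite.op (algebraMap K (LeavittPathAlgebra K G) (star k)) := by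
  rw [← AlgHom.commutes (mk K G), starHom_mk, AlgHom.commutes, algebraMap_conj,
    RingEquiv.symm_apply_apply]

theorem starHom_starHom (a : LeavittPathAlgebra K G) :
    (starHom K G (starHom K G a).unop).unop = a := by
  let F : LeavittPathAlgebra K G →+* LeavittPathAlgebra K G :=
    ((RingEquiv.opOp (LeavittPathAlgebra K G)).symm : _ →+* LeavittPathAlgebra K G).comp
      ((RingHom.op (starHom K G)).comp (starHom K G))
  have h : F = RingHom.id _ := by
    apply ringHom_ext
    · intro k
      change (starHom K G (starHom K G (algebraMap K _ k)).unop).unop = algebraMap K _ k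
      simp [starHom_algebraMap]
    · intro x
      change (starHom K G (starHom K G (gen K G x)).unop).unop = gen K G x
      rcases x with v | e | e <;> simp [starHom_gen, genStar]
  exact congrArg (fun f : _ →+* _ => f a) h

/-- The involution of `L_K(E)`: the conjugate-linear anti-automorphism that fixes the vertices and
exchanges `e` and `e*`, so that `(∑ k_{p,q} p q*)* = ∑ star k_{p,q} q p*`. -/
noncomputable instance instStarRing : StarRing (LeavittPathAlgebra K G) where
  star a := (starHom K G a).unop
  star_involutive := starHom_starHom
  star_mul a b := by simp
  star_add a b := by simp

theorem star_def (a : LeavittPathAlgebra K G) : star a = (starHom K G a).unop := rfl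

theorem star_vert (v : V) : star (gen K G (.vert v)) = gen K G (.vert v) := by
  rw [star_def, starHom_gen]; rfl

theorem star_edge (e : E) : star (gen K G (.edge e)) = gen K G (.ghost e) := by
  rw [star_def, starHom_gen]; rfl

theorem star_ghost (e : E) : star (gen K G (.ghost e)) = gen K G (.edge e) := by
  rw [star_def, starHom_gen]; rfl

instance instStarModule : StarModule K (LeavittPathAlgebra K G) where
  star_smul k a := by
    rw [Algebra.smul_def, Algebra.smul_def, star_mul, star_def (algebraMap _ _ k),
      starHom_algebraMap, MulOpposite.unop_op, Algebra.commutes]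

end Star

end LeavittPathAlgebra

/-! Both algebras are algebras of block diagonal matrices, and the ring structure alone determines
the blocks up to a bijection.

In a finite no-exit graph let `B` consist of the sinks and one vertex of each cycle. The paths that
end in `B` and meet `B` only at their end are finite in number. The Leavitt path algebra acts on the
free `K[T;T⁻¹]`-module on these paths by prepending edges. An edge that leaves a vertex `b` of `B`
starts the cycle at `b`, so the path it completes is one full turn, and it counts as `T` times the
path of length zero at `b`. This representation `rep` is injective (`rep_injective`). Its image
(`range_rep`) has one block per vertex of `B`: all matrices over `K` for a sink, all matrices over
`K[T;T⁻¹]` for a cycle, indexed by the paths ending there. It turns the involution into the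
conjugate transpose with `T` sent to `T⁻¹` (`rep_star`).

Conversely, the identities of the blocks are the minimal central idempotents. A block belongs to a
sink exactly when the nonzero central elements in its corner are invertible there, and sizes are
compared through orthogonal idempotents. So a ring isomorphism yields a bijection of blocks
preserving size and kind (`blockSubalgebra.exists_equiv_of_ringEquiv`). The ring isomorphism itself
is then discarded: reindexing matrices along the bijection is `K`-linear and commutes with the
conjugate transpose, hence gives a `*`-isomorphism. -/

/-! ### Ring-theoretic invariants of central idempotents -/

/-- A minimal nonzero central idempotent. -/
structure IsCentralAtom {A : Type*} [Ring A] (e : A) : Prop where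
  ne_zero : e ≠ 0
  mul_self : e * e = e
  central : ∀ a, e * a = a * e
  atom : ∀ f : A, f * f = f → (∀ a, f * a = a * f) → e * f = 0 ∨ e * f = e

theorem IsCentralAtom.map {A A' : Type*} [Ring A] [Ring A'] {e : A} (he : IsCentralAtom e)
    (Φ : A ≃+* A') : IsCentralAtom (Φ e) where
  ne_zero := by simpa using he.ne_zero
  mul_self := by rw [← map_mul, he.mul_self]
  central a := by
    obtain ⟨a, rfl⟩ := Φ.surjective a
    rw [← map_mul, he.central, map_mul]
  atom f hf hc := by
    obtain ⟨f, rfl⟩ := Φ.surjective f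
    have h := he.atom f (Φ.injective (by simpa using hf))
      (fun a => Φ.injective (by simpa using hc (Φ a)))
    rcases h with h | h
    · left; rw [← map_mul, h, map_zero]
    · right; rw [← map_mul, h]

/-- The nonzero central elements of the corner of `e` are invertible in the corner. -/
def IsFieldCorner {A : Type*} [Ring A] (e : A) : Prop :=
  ∀ z : A, z ≠ 0 → e * z = z → (∀ a, z * a = a * z) → ∃ w, z * w = e

theorem IsFieldCorner.map {A A' : Type*} [Ring A] [Ring A'] {e : A} (he : IsFieldCorner e)
    (Φ : A ≃+* A') : IsFieldCorner (Φ e) := by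
  intro z hz hez hc
  obtain ⟨z, rfl⟩ := Φ.surjective z
  obtain ⟨w, hw⟩ := he z (by simpa using hz) (Φ.injective (by simpa using hez))
    (fun a => Φ.injective (by simpa using hc (Φ a)))
  exact ⟨Φ w, by rw [← map_mul, hw]⟩

/-! ### Block diagonal matrix algebras and their recovery from the ring structure -/

/-- The block diagonal matrices over `R`, with blocks the fibres of `c`, whose entries in the
blocks over `P` are scalars of `K`. -/
def blockSubalgebra (K R : Type*) [CommRing K] [CommRing R] [Algebra K R] {X B : Type*} [Fintype X]
    [DecidableEq X] (c : X → B) (P : B → Prop) : Subalgebra K (Matrix X X R) where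
  carrier := {M | (∀ x y, c x ≠ c y → M x y = 0) ∧
    ∀ x y, P (c x) → M x y ∈ (⊥ : Subalgebra K R)}
  mul_mem' := by
    rintro M N ⟨hM, hM'⟩ ⟨hN, hN'⟩
    refine ⟨fun x y hxy => ?_, fun x y hx => ?_⟩
    · rw [Matrix.mul_apply]
      refine Finset.sum_eq_zero fun z _ => ?_
      by_cases h : c x = c z
      · rw [hN z y (fun h' => hxy (h.trans h')), mul_zero]
      · rw [hM x z h, zero_mul]
    · rw [Matrix.mul_apply]
      refine Subalgebra.sum_mem _ fun z _ => ?_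
      by_cases h : c x = c z
      · exact Subalgebra.mul_mem _ (hM' x z hx) (hN' z y (h ▸ hx))
      · rw [hM x z h, zero_mul]
        exact Subalgebra.zero_mem _
  add_mem' := by
    rintro M N ⟨hM, hM'⟩ ⟨hN, hN'⟩
    refine ⟨fun x y hxy => ?_, fun x y hx => ?_⟩
    · rw [Matrix.add_apply, hM x y hxy, hN x y hxy, add_zero]
    · exact Subalgebra.add_mem _ (hM' x y hx) (hN' x y hx)
  algebraMap_mem' k := by
    refine ⟨fun x y hxy => ?_, fun x y hx => ?_⟩
    · rw [Matrix.algebraMap_matrix_apply, if_neg (fun h => hxy (congrArg c h))]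
    · rw [Matrix.algebraMap_matrix_apply]
      split_ifs
      · exact Subalgebra.algebraMap_mem _ k
      · exact Subalgebra.zero_mem _

namespace blockSubalgebra

variable {K R : Type*} [CommRing K] [CommRing R] [Algebra K R] {X B : Type*} [Fintype X]
  [DecidableEq X] {c : X → B} {P : B → Prop}

theorem single_mem {x y : X} {r : R} (h : c x = c y) (hr : P (c x) → r ∈ (⊥ : Subalgebra K R)) :
    Matrix.single x y r ∈ blockSubalgebra K R c P := by
  refine ⟨fun i j hij => ?_, fun i j hi => ?_⟩
  · refine Matrix.single_apply_of_ne _ _ _ _ _ ?_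
    rintro ⟨rfl, rfl⟩
    exact hij h
  · rw [Matrix.single_apply]
    split_ifs with hh
    · exact hr (hh.1 ▸ hi)
    · exact Subalgebra.zero_mem _

theorem diagonal_mem {d : X → R} (hd : ∀ x, P (c x) → d x ∈ (⊥ : Subalgebra K R)) :
    Matrix.diagonal d ∈ blockSubalgebra K R c P := by
  refine ⟨fun i j hij => ?_, fun i j hi => ?_⟩
  · exact Matrix.diagonal_apply_ne _ (fun h => hij (congrArg c h))
  · rw [Matrix.diagonal_apply]
    split_ifs
    · exact hd i hi
    · exact Subalgebra.zero_mem _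

/-- A matrix unit whose indices lie in the same block. -/
def unit (K R : Type*) [CommRing K] [CommRing R] [Algebra K R] (c : X → B) (P : B → Prop) (x y : X)
    (h : c x = c y) : blockSubalgebra K R c P :=
  ⟨Matrix.single x y 1, single_mem h fun _ => Subalgebra.one_mem _⟩

/-- The scalar `r` in the block over `b`. -/
def scalar [DecidableEq B] (K : Type*) {R : Type*} [CommRing K] [CommRing R] [Algebra K R]
    (c : X → B) (P : B → Prop) (b : B) (r : R)
    (hr : P b → r ∈ (⊥ : Subalgebra K R)) : blockSubalgebra K R c P :=
  ⟨Matrix.diagonal fun x => if c x = b then r else 0, diagonal_mem fun x hx => by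
    split_ifs with h
    · exact hr (h ▸ hx)
    · exact Subalgebra.zero_mem _⟩

/-- The identity of the block over `b`. -/
def blockOne [DecidableEq B] (K R : Type*) [CommRing K] [CommRing R] [Algebra K R]
    (c : X → B) (P : B → Prop) (b : B) : blockSubalgebra K R c P :=
  scalar K c P b 1 fun _ => Subalgebra.one_mem _

/-- Commuting with matrix units inside the blocks leaves a central element no freedom except one
scalar per block; this and the next two lemmas compute the centre. -/
theorem diag_eq_of_central {z : blockSubalgebra K R c P} (hz : ∀ a, z * a = a * z) {x y : X}
    (h : c x = c y) : z.1 x x = z.1 y y := by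
  have h1 := congrArg (fun a : blockSubalgebra K R c P => a.1 x y) (hz (unit K R c P x y h))
  simpa [unit] using h1

theorem apply_eq_zero_of_central {z : blockSubalgebra K R c P} (hz : ∀ a, z * a = a * z) {x y : X}
    (h : x ≠ y) : z.1 x y = 0 := by
  have h1 := congrArg (fun a : blockSubalgebra K R c P => a.1 x y) (hz (unit K R c P y y rfl))
  simpa [unit, h] using h1

theorem eq_diagonal_of_central {z : blockSubalgebra K R c P} (hz : ∀ a, z * a = a * z) :
    z.1 = Matrix.diagonal fun x => z.1 x x := by
  ext x y
  rw [Matrix.diagonal_apply]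
  split_ifs with h
  · rw [h]
  · exact apply_eq_zero_of_central hz h

variable [DecidableEq B]

theorem scalar_central (b : B) (r : R) (hr : P b → r ∈ (⊥ : Subalgebra K R))
    (a : blockSubalgebra K R c P) : scalar K c P b r hr * a = a * scalar K c P b r hr := by
  apply Subtype.ext
  ext x y
  change ((Matrix.diagonal _ : Matrix X X R) * a.1) x y = (a.1 * (Matrix.diagonal _ : Matrix X X R)) x y
  rw [Matrix.diagonal_mul, Matrix.mul_diagonal]
  by_cases h : c x = c y
  · rw [h, mul_comm]
  · rw [a.2.1 x y h, mul_zero, zero_mul]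

theorem scalar_mul_scalar (b : B) (r s : R) (hr : P b → r ∈ (⊥ : Subalgebra K R))
    (hs : P b → s ∈ (⊥ : Subalgebra K R)) :
    scalar K c P b r hr * scalar K c P b s hs =
      scalar K c P b (r * s) fun h => Subalgebra.mul_mem _ (hr h) (hs h) := by
  apply Subtype.ext
  change Matrix.diagonal _ * Matrix.diagonal _ = Matrix.diagonal _
  rw [Matrix.diagonal_mul_diagonal]
  congr 1
  ext x
  split_ifs <;> simp

theorem scalar_ne_zero {x : X} {r : R} (h0 : r ≠ 0)
    (hr : P (c x) → r ∈ (⊥ : Subalgebra K R)) : scalar K c P (c x) r hr ≠ 0 := by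
  intro h
  have := congrArg (fun a : blockSubalgebra K R c P => a.1 x x) h
  exact h0 (by simpa [scalar] using this)

theorem blockOne_mul_eq_scalar {x : X} {z : blockSubalgebra K R c P} (hz : ∀ a, z * a = a * z) :
    blockOne K R c P (c x) * z = scalar K c P (c x) (z.1 x x) (z.2.2 x x) := by
  apply Subtype.ext
  change Matrix.diagonal _ * z.1 = Matrix.diagonal _
  rw [eq_diagonal_of_central hz, Matrix.diagonal_mul_diagonal]
  congr 1
  ext y
  split_ifs with h
  · simp [diag_eq_of_central hz h]
  · simp

/-- Central elements of the corner are scalars on the block. They range over the field `K` when `P`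
holds and over all of `R` otherwise, and `R` is not a field. This is how a ring isomorphism tells
sinks from cycles. -/
theorem isFieldCorner_blockOne_iff {K : Type*} [Field K] [Algebra K R]
    (hR : ∃ r : R, r ≠ 0 ∧ ¬ IsUnit r) (x : X) :
    IsFieldCorner (blockOne K R c P (c x)) ↔ P (c x) := by
  constructor
  · intro h
    by_contra hP
    obtain ⟨r, hr0, hr⟩ := hR
    obtain ⟨w, hw⟩ := h (scalar K c P (c x) r fun h => (hP h).elim) (scalar_ne_zero hr0 _)
      (by rw [blockOne, scalar_mul_scalar]; congr 1; exact one_mul r) (scalar_central _ _ _)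
    have h2 := congrArg (fun a : blockSubalgebra K R c P => a.1 x x) hw
    change ((Matrix.diagonal _ : Matrix X X R) * w.1) x x = (Matrix.diagonal _ : Matrix X X R) x x at h2
    rw [Matrix.diagonal_mul, Matrix.diagonal_apply_eq, if_pos rfl, if_pos rfl] at h2
    exact hr (IsUnit.of_mul_eq_one _ h2)
  · intro hP z hz hez hc
    rw [blockOne_mul_eq_scalar hc] at hez
    obtain ⟨k, hk⟩ := Algebra.mem_bot.1 (z.2.2 x x hP)
    have hk0 : k ≠ 0 := by
      rintro rfl
      apply hz
      rw [← hez]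
      apply Subtype.ext
      simp [scalar, ← hk]
    refine ⟨scalar K c P (c x) (algebraMap K R k⁻¹) fun _ => Subalgebra.algebraMap_mem _ _, ?_⟩
    rw [← hez, scalar_mul_scalar, blockOne]
    congr 1
    rw [← hk, ← map_mul, mul_inv_cancel₀ hk0, map_one]

variable [IsDomain R]

/-- A central idempotent is an idempotent scalar on each block, and a domain has only the
idempotents 0 and 1. -/
theorem isCentralAtom_blockOne (x : X) : IsCentralAtom (blockOne K R c P (c x)) where
  ne_zero := scalar_ne_zero one_ne_zero _
  mul_self := by
    rw [blockOne, scalar_mul_scalar]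
    congr 1
    exact mul_one 1
  central := scalar_central _ _ _
  atom f hf hc := by
    have h1 : f.1 x x * f.1 x x = f.1 x x := by
      have h2 := congrArg (fun a : blockSubalgebra K R c P => a.1 x x) hf
      change (f.1 * f.1) x x = f.1 x x at h2
      rw [eq_diagonal_of_central hc, Matrix.diagonal_mul_diagonal] at h2
      simpa using h2
    rw [blockOne_mul_eq_scalar hc]
    rcases IsIdempotentElem.iff_eq_zero_or_one.1 h1 with h | h
    · left
      apply Subtype.ext
      simp [scalar, h]
    · right
      simp [blockOne, h]

/-- Two central atoms with nonzero product are both equal to that product; a nonzero diagonal entry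
shows which block identity to multiply by. -/
theorem exists_eq_blockOne {e : blockSubalgebra K R c P} (he : IsCentralAtom e) :
    ∃ x, e = blockOne K R c P (c x) := by
  obtain ⟨x, hx⟩ : ∃ x, e.1 x x ≠ 0 := by
    by_contra! h
    refine he.ne_zero (Subtype.ext ?_)
    rw [eq_diagonal_of_central he.central]
    simp [h]
  refine ⟨x, ?_⟩
  have h0 : blockOne K R c P (c x) * e ≠ 0 := by
    rw [blockOne_mul_eq_scalar he.central]
    exact scalar_ne_zero hx _
  have hb := isCentralAtom_blockOne (K := K) (R := R) (P := P) (c := c) x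
  have h1 := (hb.atom e he.mul_self he.central).resolve_left h0
  have h2 := (he.atom _ hb.mul_self hb.central).resolve_left (by rwa [he.central])
  rw [← h2, he.central, h1]

variable {X' B' : Type*} [Fintype X'] [DecidableEq X'] [DecidableEq B'] {c' : X' → B'}
  {P' : B' → Prop}

/-- The diagonal matrix units of the block over `b` are sent to nonzero orthogonal idempotents
supported in the block over `b'`. A nonzero column from each gives linearly independent vectors, so
the rank bounds their number. Only multiplicativity of `Φ` is used, since `Φ` need not be linear
over `K` or `R`. -/
theorem card_fibre_le (Φ : blockSubalgebra K R c P ≃+* blockSubalgebra K R c' P') {b : B} {b' : B'}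
    (h : Φ (blockOne K R c P b) = blockOne K R c' P' b') :
    Fintype.card {x // c x = b} ≤ Fintype.card {x // c' x = b'} := by
  have hne : ∀ x : {x // c x = b}, Φ (unit K R c P x x rfl) ≠ 0 := by
    intro x hx
    have h1 := congrArg (fun a : blockSubalgebra K R c P => a.1 x x)
      ((map_eq_zero_iff Φ Φ.injective).1 hx)
    simp [unit] at h1
  let p : {x // c x = b} → Matrix X' X' R := fun x => (Φ (unit K R c P x x rfl)).1
  have hcol : ∀ x, ∃ j, ∃ i, p x i j ≠ 0 := by
    intro x
    by_contra! h1
    exact hne x (Subtype.ext (by ext i j; exact h1 j i))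
  choose j hj using hcol
  have hsupp : ∀ x i j, c' i ≠ b' → p x i j = 0 := by
    intro x i j hi
    have h1 : blockOne K R c P b * unit K R c P x x rfl = unit K R c P x x rfl := by
      apply Subtype.ext
      change Matrix.diagonal _ * Matrix.single _ _ _ = Matrix.single _ _ _
      ext k l
      rw [Matrix.diagonal_mul, Matrix.single_apply]
      split_ifs with h2 h3 h3
      · rw [mul_one]
      · rw [mul_zero]
      · exact absurd (h3.1 ▸ x.2) h2
      · rw [mul_zero]
    have h2 := congrArg (fun a => (Φ a).1 i j) h1
    rw [map_mul, h] at h2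
    change ((Matrix.diagonal _ : Matrix X' X' R) * p x) i j = p x i j at h2
    rw [Matrix.diagonal_mul, if_neg hi, zero_mul] at h2
    exact h2.symm
  have hmul : ∀ x y, p y * p x = if x = y then p x else 0 := by
    intro x y
    have h1 : unit K R c P y y rfl * unit K R c P x x rfl =
        if x = y then unit K R c P x x rfl else 0 := by
      apply Subtype.ext
      split_ifs with h2
      · subst h2
        exact (Matrix.single_mul_single_same _ _ _ _ _).trans (by rw [mul_one]; rfl)
      · exact Matrix.single_mul_single_of_ne _ _ _ _ (fun h3 => h2 (Subtype.ext h3.symm)) _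
    have h2 := congrArg (fun a => (Φ a).1) h1
    rw [map_mul] at h2
    refine h2.trans ?_
    split_ifs
    · rfl
    · rw [map_zero]; rfl
  let v : {x // c x = b} → {x // c' x = b'} → R := fun x i => p x i (j x)
  have hv : LinearIndependent R v := by
    rw [Fintype.linearIndependent_iff]
    intro g hg y
    have hg' : ∀ i, ∑ x, g x * p x i (j x) = 0 := by
      intro i
      by_cases hi : c' i = b'
      · simpa [v] using congrFun hg ⟨i, hi⟩
      · exact Finset.sum_eq_zero fun x _ => by rw [hsupp x i _ hi, mul_zero]
    obtain ⟨i, hi⟩ := hj y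
    -- Apply the idempotent `p y` to the relation: by orthogonality only the term of `y` survives.
    have h1 : ∑ x, g x * (p y * p x) i (j x) = 0 := by
      simp only [Matrix.mul_apply, Finset.mul_sum]
      rw [Finset.sum_comm]
      refine Finset.sum_eq_zero fun k _ => ?_
      rw [← mul_zero (p y i k), ← hg' k, Finset.mul_sum]
      exact Finset.sum_congr rfl fun x _ => by ring
    rw [Finset.sum_eq_single y (fun x _ hx => by rw [hmul, if_neg hx]; simp) (by simp), hmul,
      if_pos rfl] at h1
    exact (mul_eq_zero.1 h1).resolve_right hi
  simpa using hv.fintype_card_le_finrank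

/-- A ring isomorphism of block algebras comes with a bijection of the blocks that preserves their
size and their type. -/
theorem exists_equiv_of_ringEquiv {K : Type*} [Field K] [Algebra K R]
    (hR : ∃ r : R, r ≠ 0 ∧ ¬ IsUnit r) (hc : Function.Surjective c) (hc' : Function.Surjective c')
    (Φ : blockSubalgebra K R c P ≃+* blockSubalgebra K R c' P') :
    ∃ (τ : X ≃ X') (σ : B ≃ B'), (∀ x, c' (τ x) = σ (c x)) ∧ ∀ b, P b ↔ P' (σ b) := by
  have key : ∀ b, ∃ b', Φ (blockOne K R c P b) = blockOne K R c' P' b' := by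
    intro b
    obtain ⟨x, rfl⟩ := hc b
    obtain ⟨y, hy⟩ := exists_eq_blockOne ((isCentralAtom_blockOne (P := P) (c := c) x).map Φ)
    exact ⟨_, hy⟩
  have key' : ∀ b', ∃ b, Φ.symm (blockOne K R c' P' b') = blockOne K R c P b := by
    intro b
    obtain ⟨x, rfl⟩ := hc' b
    obtain ⟨y, hy⟩ := exists_eq_blockOne
      ((isCentralAtom_blockOne (P := P') (c := c') x).map Φ.symm)
    exact ⟨_, hy⟩
  choose f hf using key
  choose g hg using key'
  have inj : Function.Injective (blockOne K R c P) := by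
    intro b₁ b₂ h
    obtain ⟨x, rfl⟩ := hc b₁
    by_contra hne
    have := congrArg (fun a : blockSubalgebra K R c P => a.1 x x) h
    simp [blockOne, scalar, hne] at this
  have inj' : Function.Injective (blockOne K R c' P') := by
    intro b₁ b₂ h
    obtain ⟨x, rfl⟩ := hc' b₁
    by_contra hne
    have := congrArg (fun a : blockSubalgebra K R c' P' => a.1 x x) h
    simp [blockOne, scalar, hne] at this
  -- Block identities correspond to block identities in both directions, because both kinds are
  -- exactly the central atoms.
  let σ : B ≃ B' :=
    { toFun := f
      invFun := g
      left_inv := fun b => inj (by rw [← hg, ← hf, Φ.symm_apply_apply])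
      right_inv := fun b => inj' (by rw [← hf, ← hg, Φ.apply_symm_apply]) }
  have hcard : ∀ b, Fintype.card {x // c x = b} = Fintype.card {x // c' x = σ b} := fun b =>
    le_antisymm (card_fibre_le Φ (hf b))
      (card_fibre_le Φ.symm (by rw [← Φ.symm_apply_apply (blockOne K R c P b), hf b]; rfl))
  -- Any bijections between corresponding fibres will do; they are glued over `σ`.
  let τ : X ≃ X' := (Equiv.sigmaFiberEquiv c).symm.trans
    ((Equiv.sigmaCongr σ fun b => Fintype.equivOfCardEq (hcard b)).trans
      (Equiv.sigmaFiberEquiv c'))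
  refine ⟨τ, σ, fun x => ?_, fun b => ?_⟩
  · exact (Fintype.equivOfCardEq (hcard (c x)) ⟨x, rfl⟩).2
  · obtain ⟨x, rfl⟩ := hc b
    obtain ⟨y, hy⟩ := hc' (f (c x))
    change P (c x) ↔ P' (f (c x))
    have h1 := isFieldCorner_blockOne_iff (K := K) (c := c) (P := P) hR x
    have h2 := isFieldCorner_blockOne_iff (K := K) (c := c') (P := P') hR y
    rw [hy, ← hf] at h2
    rw [← h1, ← h2]
    refine ⟨fun h => h.map Φ, fun h => ?_⟩
    simpa using h.map Φ.symm

end blockSubalgebra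

/-! ### Closed walks in no-exit graphs and the choice of base vertices -/

namespace DirectedGraph

variable {V E : Type*} (G : DirectedGraph V E)

/-- A walk from one vertex to another, as a possibly empty list of edges. -/
def IsWalk : List E → V → V → Prop
  | [], v, w => v = w
  | e :: l, v, w => G.source e = v ∧ IsWalk l (G.range e) w

/-- There is an edge from the first to the second vertex. -/
def Adj (v w : V) : Prop := ∃ e, G.source e = v ∧ G.range e = w

/-- The vertex lies on a closed walk. -/
def IsCyclic (v : V) : Prop := Relation.TransGen G.Adj v v

variable {G}

theorem IsWalk.of_append {l₁ l₂ : List E} {v w : V} {f : E} (h : G.IsWalk (l₁ ++ f :: l₂) v w) :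
    G.IsWalk (f :: l₂) (G.source f) w := by
  induction l₁ generalizing v with
  | nil => exact ⟨rfl, h.2⟩
  | cons e l ih => exact ih h.2

/-- If the source of the first edge recurs, restart the walk at the later edge with that source.
Only sources are made distinct, so a closed walk stays closed and becomes a cycle. -/
theorem IsWalk.exists_nodup {l : List E} {v w : V} (h : G.IsWalk l v w) (hl : l ≠ []) :
    ∃ l', l' ≠ [] ∧ G.IsWalk l' v w ∧ (l'.map G.source).Nodup := by
  induction l generalizing v with
  | nil => exact absurd rfl hl
  | cons e l ih =>
    by_cases hl' : l = []
    · subst hl'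
      exact ⟨[e], by simp, h, by simp⟩
    · obtain ⟨t, ht, htw, htn⟩ := ih h.2 hl'
      by_cases he : G.source e ∈ t.map G.source
      · obtain ⟨f, hf, hfe⟩ := List.mem_map.1 he
        obtain ⟨a, b, rfl⟩ := List.append_of_mem hf
        refine ⟨f :: b, by simp, ?_, ?_⟩
        · rw [← h.1, ← hfe]
          exact htw.of_append
        · rw [List.map_append] at htn
          exact htn.of_append_right
      · exact ⟨e :: t, by simp, ⟨h.1, htw⟩, List.nodup_cons.2 ⟨he, htn⟩⟩

theorem IsWalk.isPath {l : List E} {v w : V} (h : G.IsWalk l v w) (hl : l ≠ []) : G.IsPath l := by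
  refine ⟨hl, ?_⟩
  induction l generalizing v with
  | nil => exact absurd rfl hl
  | cons e l ih =>
    cases l with
    | nil => exact List.isChain_singleton _
    | cons f l => exact List.isChain_cons_cons.2 ⟨h.2.1, ih h.2 (by simp)⟩

theorem IsWalk.source_head {l : List E} {v w : V} (h : G.IsWalk l v w) (hl : l ≠ []) :
    G.source (l.head hl) = v := by
  cases l with
  | nil => exact absurd rfl hl
  | cons e l => exact h.1

theorem IsWalk.range_getLast {l : List E} {v w : V} (h : G.IsWalk l v w) (hl : l ≠ []) :
    G.range (l.getLast hl) = w := by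
  induction l generalizing v with
  | nil => exact absurd rfl hl
  | cons e l ih =>
    cases l with
    | nil => exact h.2
    | cons f l => exact ih h.2 (by simp)

theorem exists_isWalk_of_transGen {v w : V} (h : Relation.TransGen G.Adj v w) :
    ∃ l, l ≠ [] ∧ G.IsWalk l v w := by
  induction h using Relation.TransGen.head_induction_on with
  | single h =>
    obtain ⟨e, rfl, rfl⟩ := h
    exact ⟨[e], by simp, rfl, rfl⟩
  | head h _ ih =>
    obtain ⟨e, rfl, rfl⟩ := h
    obtain ⟨l, -, hl⟩ := ih
    exact ⟨e :: l, by simp, rfl, hl⟩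

namespace IsNoExit

variable (hG : G.IsNoExit)
include hG

/-- A closed walk through the source contains a cycle starting at that same vertex, and a second
edge from there would be an exit. -/
theorem edge_eq {e f : E} (h : G.IsCyclic (G.source e)) (hf : G.source f = G.source e) : f = e := by
  obtain ⟨l₀, hl₀, hw₀⟩ := exists_isWalk_of_transGen h
  obtain ⟨l, hl, hw, hn⟩ := hw₀.exists_nodup hl₀
  have hc : G.IsCycle l :=
    ⟨hw.isPath hl, ⟨hl, (hw.source_head hl).trans (hw.range_getLast hl).symm⟩, hn⟩
  have key : ∀ g, G.source g = G.source e → g = l.head hl := by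
    intro g hg
    by_contra hne
    exact hG l hc g ⟨l.head hl, List.head_mem hl, hg.trans (hw.source_head hl).symm, hne⟩
  rw [key f hf, key e rfl]

theorem adj_unique {v w w' : V} (h : G.IsCyclic v) (h₁ : G.Adj v w) (h₂ : G.Adj v w') :
    w = w' := by
  obtain ⟨e, rfl, rfl⟩ := h₁
  obtain ⟨f, hf, rfl⟩ := h₂
  rw [hG.edge_eq h hf]

/-- The only edge out of a cyclic vertex is the one that continues its closed walk, so going forward
never leaves the cycle. -/
theorem reach_symm {v w : V} (h : G.IsCyclic v) (hw : Relation.ReflTransGen G.Adj v w) :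
    G.IsCyclic w ∧ Relation.ReflTransGen G.Adj w v := by
  induction hw with
  | refl => exact ⟨h, .refl⟩
  | tail _ hbc ih =>
    obtain ⟨b', hb', hr⟩ := Relation.TransGen.head'_iff.1 ih.1
    obtain rfl := hG.adj_unique ih.1 hbc hb'
    exact ⟨Relation.TransGen.tail' hr hbc, hr.trans ih.2⟩

end IsNoExit

variable (G)

/-- The relation of mutual reachability of vertices. -/
def reachSetoid : Setoid V where
  r v w := Relation.ReflTransGen G.Adj v w ∧ Relation.ReflTransGen G.Adj w v
  iseqv := ⟨fun _ => ⟨.refl, .refl⟩, fun h => ⟨h.2, h.1⟩, fun h h' => ⟨h.1.trans h'.1, h'.2.trans h.2⟩⟩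

/-- A representative of the vertices that are mutually reachable with a given one. -/
noncomputable def rep (v : V) : V := (Quotient.mk G.reachSetoid v).out

theorem rep_rel (v : V) :
    Relation.ReflTransGen G.Adj (G.rep v) v ∧ Relation.ReflTransGen G.Adj v (G.rep v) :=
  Quotient.mk_out (s := G.reachSetoid) v

theorem rep_eq {v w : V} (h : Relation.ReflTransGen G.Adj v w)
    (h' : Relation.ReflTransGen G.Adj w v) : G.rep v = G.rep w :=
  congrArg Quotient.out (Quotient.sound (s := G.reachSetoid) ⟨h, h'⟩)

/-- The sinks, together with one vertex of each cycle. -/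
def baseSet : Set V := {v | (∀ e, G.source e ≠ v) ∨ (G.IsCyclic v ∧ G.rep v = v)}

/-- The first vertex of a path, given by its edges and its last vertex. -/
def start : List E → V → V
  | [], b => b
  | e :: _, _ => G.source e

/-- The path with the given edges and the given last vertex ends in `B`, and has no other vertex
in `B`. -/
def IsCutPath (B : Set V) : List E → V → Prop
  | [], b => b ∈ B
  | e :: l, b => G.source e ∉ B ∧ G.start l b = G.range e ∧ IsCutPath B l b

/-- A set of vertices that contains all sinks and meets every closed walk, such that an edge that
starts in it is the only one from its source, and is continued to a closed path in a unique way. -/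
structure IsCut (B : Set V) : Prop where
  wf : WellFounded fun w v => v ∉ B ∧ G.Adj v w
  edge_eq : ∀ e f, G.source e ∈ B → G.source f = G.source e → f = e
  sink_mem : ∀ v, (∀ e, G.source e ≠ v) → v ∈ B
  return_path : ∀ e, G.source e ∈ B → ∃ l, ∀ l' b, G.IsCutPath B l' b → G.start l' b = G.range e →
    l' = l ∧ b = G.source e

variable {G}

/-- Outside `baseSet` every walk terminates: by finiteness, an endless one would contain a closed
walk avoiding the set, whereas each cycle contains its chosen representative. -/
theorem IsNoExit.isCut_baseSet [Finite V] (hG : G.IsNoExit) : G.IsCut G.baseSet := by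
  have hcyc : ∀ {v w}, G.Adj v w → v ∈ G.baseSet → G.IsCyclic v ∧ G.rep v = v := by
    rintro v w ⟨e, he, -⟩ (h | h)
    · exact absurd he (h e)
    · exact h
  have wf : WellFounded fun w v => v ∉ G.baseSet ∧ G.Adj v w := by
    let r : V → V → Prop := fun v w => v ∉ G.baseSet ∧ G.Adj v w
    have hirr : ∀ v, ¬ Relation.TransGen r v v := by
      intro v hv
      have hc : ∀ {w}, Relation.TransGen r w w → G.IsCyclic w := fun h =>
        Relation.TransGen.mono (fun _ _ h => h.2) _ _ h
      -- Out-edges on a cycle are unique, so every vertex reachable from `v` lies on a closed walk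
      -- outside the base set. Applied to `G.rep v`, which is in the base set, this is absurd.
      have hreach : ∀ w, Relation.ReflTransGen G.Adj v w → Relation.TransGen r w w := by
        intro w hw
        induction hw with
        | refl => exact hv
        | tail _ hbc ih =>
          obtain ⟨b', hb', hr⟩ := Relation.TransGen.head'_iff.1 ih
          obtain rfl := hG.adj_unique (hc ih) hbc hb'.2
          exact Relation.TransGen.tail' hr hb'
      have h1 := hreach _ (G.rep_rel v).2
      obtain ⟨_, h2, -⟩ := Relation.TransGen.head'_iff.1 h1
      exact h2.1 (Or.inr ⟨hc h1, G.rep_eq (G.rep_rel v).1 (G.rep_rel v).2⟩)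
    have hwf : WellFounded (Function.swap (Relation.TransGen r)) := by
      have : IsTrans V (Function.swap (Relation.TransGen r)) := ⟨fun _ _ _ h h' => h'.trans h⟩
      have : Std.Irrefl (Function.swap (Relation.TransGen r)) := ⟨hirr⟩
      exact Finite.wellFounded_of_trans_of_irrefl _
    exact Subrelation.wf (fun {w v} h => Relation.TransGen.single (r := r) h) hwf
  refine ⟨wf, fun e f he hf => ?_, fun v hv => Or.inl hv, fun e he => ?_⟩
  · exact hG.edge_eq (hcyc ⟨e, rfl, rfl⟩ he).1 hf
  -- Follow the cycle from `w` until it meets the base set. No choice arises on the way, and the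
  -- vertex met is the representative of the cycle, hence the source of `e`.
  · have key : ∀ w, G.IsCyclic w → Relation.ReflTransGen G.Adj w (G.source e) →
        ∃ l, ∀ l' b, G.IsCutPath G.baseSet l' b → G.start l' b = w →
          l' = l ∧ b = G.source e := by
      intro w
      induction w using wf.induction with
      | h w ih =>
        intro hw hr
        obtain ⟨w', hww', hr'⟩ := Relation.TransGen.head'_iff.1 hw
        by_cases hwB : w ∈ G.baseSet
        · refine ⟨[], fun l' b hl' hs => ?_⟩
          cases l' with
          | nil =>
            refine ⟨rfl, ?_⟩
            change b = w at hs
            rw [hs, ← (hcyc hww' hwB).2, ← (hcyc ⟨e, rfl, rfl⟩ he).2]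
            exact G.rep_eq hr (hG.reach_symm hw hr).2
          | cons f l' =>
            change G.source f = w at hs
            exact absurd (hs ▸ hwB) hl'.1
        · have hc' := hG.reach_symm hw (.single hww')
          obtain ⟨l, hl⟩ := ih w' ⟨hwB, hww'⟩ hc'.1 (hc'.2.trans hr)
          obtain ⟨f, rfl, rfl⟩ := hww'
          refine ⟨f :: l, fun l' b hl' hs => ?_⟩
          cases l' with
          | nil => exact absurd (hs ▸ hl') hwB
          | cons g l' =>
            change G.source g = _ at hs
            obtain rfl := hG.edge_eq hw hs
            obtain ⟨rfl, rfl⟩ := hl l' b hl'.2.2 hl'.2.1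
            exact ⟨rfl, rfl⟩
    have he' := (hcyc ⟨e, rfl, rfl⟩ he).1
    have h := hG.reach_symm he' (.single ⟨e, rfl, rfl⟩)
    exact key _ h.1 h.2

/-! ### Paths that end at the base and the steps between them -/

variable (G) in
/-- The paths that end in `B`, and have no other vertex in `B`. -/
abbrev CutPath (B : Set V) : Type _ := {x : List E × V // G.IsCutPath B x.1 x.2}

namespace CutPath

variable {B : Set V}

/-- The first vertex. -/
def src (x : G.CutPath B) : V := G.start x.1.1 x.1.2

/-- The last vertex. -/
def last (x : G.CutPath B) : V := x.1.2

theorem last_mem (x : G.CutPath B) : x.last ∈ B := by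
  obtain ⟨⟨l, b⟩, h⟩ := x
  change b ∈ B
  induction l with
  | nil => exact h
  | cons e l ih => exact ih h.2.2

/-- The path of length zero. -/
def nil (b : V) (hb : b ∈ B) : G.CutPath B := ⟨([], b), hb⟩

/-- The path `x` is of length zero. -/
def IsNil (x : G.CutPath B) : Prop := x.1.1 = []

/-- Adjoining an edge in front of a path. -/
def cons (e : E) (he : G.source e ∉ B) (y : G.CutPath B) (h : y.src = G.range e) : G.CutPath B :=
  ⟨(e :: y.1.1, y.1.2), he, h, y.2⟩

theorem IsNil.eq_nil {x : G.CutPath B} (h : x.IsNil) : x = nil x.last x.last_mem :=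
  Subtype.ext (Prod.ext h rfl)

theorem IsNil.src_eq {x : G.CutPath B} (h : x.IsNil) : x.src = x.last := by
  rw [h.eq_nil]; rfl

theorem eq_nil_of_src_mem {x : G.CutPath B} (h : x.src ∈ B) : x = nil x.src h := by
  obtain ⟨⟨l, b⟩, hx⟩ := x
  cases l with
  | nil => rfl
  | cons e l => exact absurd h hx.1

theorem induction {p : G.CutPath B → Prop} (nil : ∀ b hb, p (nil b hb))
    (cons : ∀ e he y h, p y → p (cons e he y h)) (x : G.CutPath B) : p x := by
  obtain ⟨⟨l, b⟩, hx⟩ := x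
  induction l with
  | nil => exact nil b hx
  | cons e l ih => exact cons e hx.1 ⟨(l, b), hx.2.2⟩ hx.2.1 (ih hx.2.2)

/-- The path `y` continues the edge `e` to the path `x`, or `e` starts in `B`, and `x` is the path
of length zero at its source. -/
def Step (e : E) (x y : G.CutPath B) : Prop :=
  y.src = G.range e ∧ ((∃ he h, x = cons e he y h) ∨ ∃ he, x = nil (G.source e) he)

theorem Step.src_eq {e : E} {x y : G.CutPath B} (h : Step e x y) : x.src = G.source e := by
  rcases h.2 with ⟨_, _, rfl⟩ | ⟨_, rfl⟩ <;> rfl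

theorem Step.mem_iff {e : E} {x y : G.CutPath B} (h : Step e x y) :
    G.source e ∈ B ↔ x.IsNil := by
  rcases h.2 with ⟨he, _, rfl⟩ | ⟨he, rfl⟩
  · exact ⟨fun h => absurd h he, fun h => absurd h (List.cons_ne_nil _ _)⟩
  · exact ⟨fun _ => rfl, fun _ => he⟩

variable (hB : G.IsCut B)
include hB

theorem eq_of_src_eq_range {e : E} (he : G.source e ∈ B) {y y' : G.CutPath B}
    (hy : y.src = G.range e) (hy' : y'.src = G.range e) : y = y' := by
  obtain ⟨l, hl⟩ := hB.return_path e he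
  obtain ⟨h1, h2⟩ := hl _ _ y.2 hy
  obtain ⟨h3, h4⟩ := hl _ _ y'.2 hy'
  exact Subtype.ext (Prod.ext (h1.trans h3.symm) (h2.trans h4.symm))

/-- Steps preserve the final vertex, which is why the representation is block diagonal. -/
theorem Step.last_eq {e : E} {x y : G.CutPath B} (h : Step e x y) : x.last = y.last := by
  rcases h.2 with ⟨_, _, rfl⟩ | ⟨he, rfl⟩
  · rfl
  · obtain ⟨l, hl⟩ := hB.return_path e he
    exact (hl _ _ y.2 h.1).2.symm

theorem exists_src_eq (v : V) : ∃ y : G.CutPath B, y.src = v := by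
  induction v using hB.wf.induction with
  | h v ih =>
    by_cases hv : v ∈ B
    · exact ⟨nil v hv, rfl⟩
    · obtain ⟨e, rfl⟩ : ∃ e, G.source e = v := by
        by_contra! h
        exact hv (hB.sink_mem v h)
      obtain ⟨y, hy⟩ := ih _ ⟨hv, e, rfl, rfl⟩
      exact ⟨cons e hv y hy, rfl⟩

omit hB in
theorem exists_step {e : E} {y : G.CutPath B} (h : y.src = G.range e) : ∃ x, Step e x y := by
  by_cases he : G.source e ∈ B
  · exact ⟨nil _ he, h, .inr ⟨he, rfl⟩⟩
  · exact ⟨cons e he y h, h, .inl ⟨he, h, rfl⟩⟩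

omit hB in
theorem Step.left_unique {e : E} {x x' y : G.CutPath B} (h : Step e x y) (h' : Step e x' y) :
    x = x' := by
  rcases h.2 with ⟨he, _, rfl⟩ | ⟨he, rfl⟩ <;> rcases h'.2 with ⟨he', _, rfl⟩ | ⟨he', rfl⟩
  · rfl
  · exact absurd he' he
  · exact absurd he he'
  · rfl

theorem exists_step_of_src_eq {e : E} {x : G.CutPath B} (h : x.src = G.source e) :
    ∃ f y, Step f x y := by
  induction x using CutPath.induction with
  | nil b hb =>
    change b = _ at h
    subst h
    obtain ⟨y, hy⟩ := exists_src_eq hB (G.range e)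
    exact ⟨e, y, hy, .inr ⟨hb, rfl⟩⟩
  | cons f hf y hy _ => exact ⟨f, y, hy, .inl ⟨hf, hy, rfl⟩⟩

/-- A path of positive length determines its first edge and its remainder. At a path of length zero
the no-exit property supplies the unique edge and the unique way back. Together with
`Step.left_unique` this makes steps partial bijections, as the Leavitt relations require. -/
theorem Step.right_unique {e e' : E} {x y y' : G.CutPath B} (h : Step e x y) (h' : Step e' x y') :
    e = e' ∧ y = y' := by
  rcases h.2 with ⟨he, hy, rfl⟩ | ⟨he, rfl⟩
  · rcases h'.2 with ⟨he', hy', hx⟩ | ⟨he', hx⟩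
    · have h1 := congrArg Subtype.val hx
      simp only [cons, Prod.mk.injEq, List.cons.injEq] at h1
      exact ⟨h1.1.1, Subtype.ext (Prod.ext h1.1.2 h1.2)⟩
    · exact absurd (congrArg (fun x => x.1.1) hx) (List.cons_ne_nil _ _)
  · have h1 : e = e' := hB.edge_eq e' e (h'.src_eq ▸ he) h'.src_eq
    subst h1
    exact ⟨rfl, eq_of_src_eq_range hB he h.1 h'.1⟩

/-- Well-founded induction along edges outside `B`: each path comes from one of finitely many edges
and one of finitely many shorter paths. -/
theorem finite_src_eq [Finite E] (v : V) : {x : G.CutPath B | x.src = v}.Finite := by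
  induction v using hB.wf.induction with
  | h v ih =>
    by_cases hv : v ∈ B
    · refine Set.Subsingleton.finite fun x hx y hy => ?_
      change x.src = v at hx
      change y.src = v at hy
      subst hx
      rw [eq_nil_of_src_mem hv, eq_nil_of_src_mem (hy ▸ hv : y.src ∈ B)]
      simp only [hy]
    · have h : (⋃ e ∈ {e | G.source e = v}, ⋃ y ∈ {y : G.CutPath B | y.src = G.range e},
          {x : G.CutPath B | Step e x y}).Finite := by
        refine (Set.toFinite _).biUnion fun e he => (ih _ ⟨hv, e, he, rfl⟩).biUnion fun y _ => ?_
        exact Set.Subsingleton.finite fun x hx x' hx' => Step.left_unique hx hx'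
      refine h.subset fun x hx => ?_
      obtain ⟨e, he⟩ : ∃ e, G.source e = v := by
        by_contra! h
        exact hv (hB.sink_mem v h)
      obtain ⟨f, y, hf⟩ := exists_step_of_src_eq hB (hx.trans he.symm)
      simp only [Set.mem_iUnion]
      exact ⟨f, hf.src_eq.symm.trans hx, y, hf.1, hf⟩

theorem finite [Finite V] [Finite E] : Finite (G.CutPath B) := by
  refine Set.finite_univ_iff.1 ((Set.finite_iUnion (finite_src_eq hB)).subset fun x _ => ?_)
  exact Set.mem_iUnion.2 ⟨x.src, rfl⟩

end CutPath

end DirectedGraph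

/-! ### Laurent polynomials and their involution -/

open scoped LaurentPolynomial

open LaurentPolynomial (T)

section Conj

variable {K : Type*} [Field K] [StarRing K]

/-- The involution of the Laurent polynomials that inverts `T` and conjugates the coefficients. -/
noncomputable def LaurentPolynomial.conj : K[T;T⁻¹] →+* K[T;T⁻¹] :=
  (LaurentPolynomial.invert : K[T;T⁻¹] ≃ₐ[K] K[T;T⁻¹]).toAlgHom.toRingHom.comp
    (AddMonoidAlgebra.mapRingHom ℤ (starRingEnd K))

@[simp]
theorem LaurentPolynomial.conj_T (n : ℤ) : LaurentPolynomial.conj (T n : K[T;T⁻¹]) = T (-n) := by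
  change LaurentPolynomial.invert (AddMonoidAlgebra.mapRingHom ℤ (starRingEnd K) (.single n 1)) = _
  rw [AddMonoidAlgebra.mapRingHom_single, map_one]
  exact LaurentPolynomial.invert_T n

@[simp]
theorem LaurentPolynomial.conj_algebraMap (k : K) :
    LaurentPolynomial.conj (algebraMap K K[T;T⁻¹] k) = algebraMap K K[T;T⁻¹] (star k) := by
  rw [← LaurentPolynomial.C_eq_algebraMap, ← LaurentPolynomial.C_eq_algebraMap]
  change LaurentPolynomial.invert (AddMonoidAlgebra.mapRingHom ℤ (starRingEnd K) (.single 0 k)) = _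
  rw [AddMonoidAlgebra.mapRingHom_single]
  exact LaurentPolynomial.invert_C _

/-- `T - 1` is nonzero and vanishes under evaluation at 1. -/
theorem LaurentPolynomial.exists_ne_zero_not_isUnit (K : Type*) [Field K] :
    ∃ r : K[T;T⁻¹], r ≠ 0 ∧ ¬ IsUnit r := by
  refine ⟨T 1 - 1, fun h => ?_, fun h => ?_⟩
  · have h1 := congrArg (fun p : K[T;T⁻¹] => p.coeff 1) h
    simp [← LaurentPolynomial.T_zero] at h1
  · have h1 := h.map (LaurentPolynomial.eval₂ (RingHom.id K) (1 : Kˣ))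
    simp at h1

/-- The conjugate transpose of a matrix of Laurent polynomials. -/
noncomputable def Matrix.laurentConjTranspose {X : Type*} (M : Matrix X X K[T;T⁻¹]) :
    Matrix X X K[T;T⁻¹] := (M.map LaurentPolynomial.conj).transpose

theorem Matrix.laurentConjTranspose_single {X : Type*} [DecidableEq X] (x y : X) (r : K[T;T⁻¹]) :
    (Matrix.single x y r).laurentConjTranspose =
      Matrix.single y x (LaurentPolynomial.conj r) := by
  ext i j : 1
  simp only [Matrix.laurentConjTranspose, Matrix.transpose_apply, Matrix.map_apply,
    Matrix.single_apply]
  rw [apply_ite LaurentPolynomial.conj, map_zero]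
  congr 1
  exact propext and_comm

end Conj

/-! ### The representation by matrices over Laurent polynomials -/

namespace LeavittPathAlgebra

open Leavitt

theorem induction {K : Type*} [Field K] {V E : Type*} [Fintype V] [Fintype E]
    {G : DirectedGraph V E} {p : LeavittPathAlgebra K G → Prop}
    (algebraMap : ∀ k, p (algebraMap K _ k)) (gen : ∀ x, p (gen K G x))
    (mul : ∀ a b, p a → p b → p (a * b)) (add : ∀ a b, p a → p b → p (a + b))
    (a : LeavittPathAlgebra K G) : p a := by
  obtain ⟨b, rfl⟩ : ∃ b, mk K G b = a := RingQuot.mkAlgHom_surjective K (Leavitt.Rel K G) a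
  induction b using FreeAlgebra.induction with
  | grade0 k => simpa using algebraMap k
  | grade1 x => exact gen x
  | mul a b ha hb => simpa using mul _ _ ha hb
  | add a b ha hb => simpa using add _ _ ha hb

section Relations

variable (K : Type*) [Field K] {V E : Type*} [Fintype V] [Fintype E] (G : DirectedGraph V E)

/-- A vertex. -/
noncomputable abbrev vert (v : V) : LeavittPathAlgebra K G := gen K G (.vert v)

/-- An edge. -/
noncomputable abbrev edge (e : E) : LeavittPathAlgebra K G := gen K G (.edge e)

/-- A ghost edge. -/
noncomputable abbrev ghost (e : E) : LeavittPathAlgebra K G := gen K G (.ghost e)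

variable {K G}

theorem vert_mul_self (v : V) : vert K G v * vert K G v = vert K G v := by
  simpa [fVert, fEdge, fGhost, mk_ι] using mk_rel (Rel.vert_mul_self (K := K) (G := G) v)

theorem vert_mul_of_ne {v w : V} (h : v ≠ w) : vert K G v * vert K G w = 0 := by
  simpa [fVert, fEdge, fGhost, mk_ι] using mk_rel (Rel.vert_mul_of_ne (K := K) (G := G) v w h)

theorem source_mul_edge (e : E) : vert K G (G.source e) * edge K G e = edge K G e := by
  simpa [fVert, fEdge, fGhost, mk_ι] using mk_rel (Rel.source_mul_edge (K := K) (G := G) e)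

theorem edge_mul_range (e : E) : edge K G e * vert K G (G.range e) = edge K G e := by
  simpa [fVert, fEdge, fGhost, mk_ι] using mk_rel (Rel.edge_mul_range (K := K) (G := G) e)

theorem range_mul_ghost (e : E) : vert K G (G.range e) * ghost K G e = ghost K G e := by
  simpa [fVert, fEdge, fGhost, mk_ι] using mk_rel (Rel.range_mul_ghost (K := K) (G := G) e)

theorem ghost_mul_source (e : E) : ghost K G e * vert K G (G.source e) = ghost K G e := by
  simpa [fVert, fEdge, fGhost, mk_ι] using mk_rel (Rel.ghost_mul_source (K := K) (G := G) e)

theorem ghost_mul_edge_self (e : E) : ghost K G e * edge K G e = vert K G (G.range e) := by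
  simpa [fVert, fEdge, fGhost, mk_ι] using mk_rel (Rel.ghost_mul_edge_self (K := K) (G := G) e)

theorem ghost_mul_edge_of_ne {e f : E} (h : e ≠ f) : ghost K G e * edge K G f = 0 := by
  simpa [fVert, fEdge, fGhost, mk_ι] using mk_rel (Rel.ghost_mul_edge_of_ne (K := K) (G := G) e f h)

open Classical in
theorem vert_eq_sum {v : V} (h : ∃ e, G.source e = v) :
    vert K G v = ∑ e with G.source e = v, edge K G e * ghost K G e := by
  simpa [fVert, fEdge, fGhost, mk_ι] using mk_rel (Rel.vert_eq_sum (K := K) (G := G) v h)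

theorem sum_vert : ∑ v, vert K G v = 1 := by
  simpa [fVert, fEdge, fGhost, mk_ι] using (mk_rel (Rel.one (K := K) (G := G))).symm

end Relations

section Rep

open DirectedGraph DirectedGraph.CutPath

variable (K : Type*) [Field K] {V E : Type*} {G : DirectedGraph V E} {B : Set V}

open Classical in
/-- The weight of a step from `x`. -/
noncomputable def weight (x : G.CutPath B) : K[T;T⁻¹] := if x.IsNil then T 1 else 1

open Classical in
/-- The inverse of the weight of a step from `x`. -/
noncomputable def weightInv (x : G.CutPath B) : K[T;T⁻¹] := if x.IsNil then T (-1) else 1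

theorem weight_mul_weightInv (x : G.CutPath B) : weight K x * weightInv K x = 1 := by
  unfold weight weightInv
  split_ifs
  · rw [← LaurentPolynomial.T_add]; simp
  · simp

open Classical in
/-- The action of the generators of the Leavitt path algebra on the free module with basis the
paths that end in `B`. -/
noncomputable def repGen (B : Set V) : Gen V E → Matrix (G.CutPath B) (G.CutPath B) K[T;T⁻¹]
  | .vert v => Matrix.diagonal fun x => if x.src = v then 1 else 0
  | .edge e => Matrix.of fun x y => if Step e x y then weight K x else 0
  | .ghost e => Matrix.of fun y x => if Step e x y then weightInv K x else 0

variable [Fintype V] [Fintype E] (hB : G.IsCut B) [Fintype (G.CutPath B)]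
include hB

-- Each relation expresses that steps are partial bijections: a path from the range of `e` has
-- exactly one extension by `e`, and a path whose source emits an edge arises from exactly one step.
-- Each sum thus reduces to at most one term, where the weights cancel.
open Classical in
theorem repGen_rel {a b : FreeAlgebra K (Gen V E)} (h : Rel K G a b) :
    FreeAlgebra.lift K (repGen (G := G) K B) a = FreeAlgebra.lift K (repGen (G := G) K B) b := by
  cases h <;> simp only [fVert, fEdge, fGhost, map_mul, map_zero, map_one, map_sum,
    FreeAlgebra.lift_ι_apply]
  case vert_mul_self v => simp [repGen]
  case vert_mul_of_ne v w h =>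
    simp only [repGen, Matrix.diagonal_mul_diagonal, ← Matrix.diagonal_zero]
    congr 1
    ext x
    split_ifs <;> simp_all
  case source_mul_edge e =>
    ext x y : 1
    simp only [repGen, Matrix.diagonal_mul, Matrix.of_apply]
    split_ifs with h1 h2 h2
    · simp
    · simp
    · exact absurd h2.src_eq h1
    · simp
  case edge_mul_range e =>
    ext x y : 1
    simp only [repGen, Matrix.mul_diagonal, Matrix.of_apply]
    split_ifs with h1 h2 h2
    · simp
    · exact absurd h1.1 h2
    · simp
    · simp
  case range_mul_ghost e =>
    ext y x : 1
    simp only [repGen, Matrix.diagonal_mul, Matrix.of_apply]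
    split_ifs with h1 h2 h2
    · simp
    · simp
    · exact absurd h2.1 h1
    · simp
  case ghost_mul_source e =>
    ext y x : 1
    simp only [repGen, Matrix.mul_diagonal, Matrix.of_apply]
    split_ifs with h1 h2 h2
    · simp
    · exact absurd h1.src_eq h2
    · simp
    · simp
  case ghost_mul_edge_self e =>
    ext y y' : 1
    simp only [repGen, Matrix.mul_apply, Matrix.of_apply, Matrix.diagonal_apply]
    by_cases hy : y.src = G.range e
    · obtain ⟨x, hx⟩ := exists_step hy
      rw [Finset.sum_eq_single x]
      · rw [if_pos hx]
        by_cases hyy : y = y'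
        · subst hyy
          rw [if_pos hx, if_pos rfl, if_pos hy, mul_comm, weight_mul_weightInv]
        · rw [if_neg hyy, if_neg fun h => hyy (Step.right_unique hB hx h).2, mul_zero]
      · intro x' _ hne
        rw [if_neg fun h => hne (h.left_unique hx), zero_mul]
      · simp
    · rw [if_neg hy, ite_self]
      exact Finset.sum_eq_zero fun x _ => by rw [if_neg fun h : Step e x y => hy h.1, zero_mul]
  case ghost_mul_edge_of_ne e f h =>
    ext y y' : 1
    simp only [repGen, Matrix.mul_apply, Matrix.of_apply, Matrix.zero_apply]
    refine Finset.sum_eq_zero fun x _ => ?_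
    split_ifs with h1 h2
    · exact absurd (Step.right_unique hB h1 h2).1 h
    all_goals simp
  case vert_eq_sum v h =>
    ext x x' : 1
    simp only [repGen, Matrix.sum_apply, Matrix.mul_apply, Matrix.of_apply, Matrix.diagonal_apply]
    by_cases hx : x.src = v
    · obtain ⟨e, rfl⟩ := h
      obtain ⟨f, y, hf⟩ := exists_step_of_src_eq hB hx
      rw [Finset.sum_eq_single f, Finset.sum_eq_single y, if_pos hf, if_pos hx]
      · by_cases hxx : x = x'
        · subst hxx
          rw [if_pos hf, if_pos rfl, weight_mul_weightInv]
        · rw [if_neg hxx, if_neg fun h => hxx (hf.left_unique h), mul_zero]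
      · intro y' _ hy'
        rw [if_neg fun h => hy' (Step.right_unique hB h hf).2, zero_mul]
      · simp
      · intro e' _ he'
        refine Finset.sum_eq_zero fun y' _ => ?_
        rw [if_neg fun h => he' (Step.right_unique hB h hf).1, zero_mul]
      · intro h
        exact absurd (hf.src_eq.symm.trans hx) (by simpa using h)
    · rw [if_neg hx, ite_self]
      refine (Finset.sum_eq_zero fun e he => Finset.sum_eq_zero fun y _ => ?_).symm
      rw [if_neg fun h : Step e x y => hx (h.src_eq.trans (Finset.mem_filter.1 he).2), zero_mul]
  case one =>
    ext x y : 1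
    simp only [repGen, Matrix.sum_apply, Matrix.diagonal_apply, Matrix.one_apply]
    split_ifs <;> simp

open Classical in
/-- The representation of the Leavitt path algebra on the free module with basis the paths that
end in `B`. -/
noncomputable def rep : LeavittPathAlgebra K G →ₐ[K] Matrix (G.CutPath B) (G.CutPath B) K[T;T⁻¹] :=
  RingQuot.liftAlgHom K ⟨FreeAlgebra.lift K (repGen (G := G) K B), fun _ _ h => repGen_rel K hB h⟩

open Classical in
theorem rep_gen (x : Gen V E) : rep K hB (gen K G x) = repGen (G := G) K B x :=
  (RingQuot.liftAlgHom_mkAlgHom_apply _ _ _ _).trans (FreeAlgebra.lift_ι_apply _ _)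

end Rep

section Star

open DirectedGraph DirectedGraph.CutPath

variable (K : Type*) [Field K] [StarRing K] {V E : Type*} {G : DirectedGraph V E} {B : Set V}

theorem conj_weight (x : G.CutPath B) :
    LaurentPolynomial.conj (weight K x) = weightInv K x := by
  unfold weight weightInv
  split_ifs <;> simp

theorem conj_weightInv (x : G.CutPath B) :
    LaurentPolynomial.conj (weightInv K x) = weight K x := by
  unfold weight weightInv
  split_ifs <;> simp

variable [Fintype V] [Fintype E] (hB : G.IsCut B) [Fintype (G.CutPath B)]

-- Edges and ghost edges have transposed supports, and conjugation exchanges `weight` with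
-- `weightInv`; both sides are compatible with sums and products, so generators and scalars suffice.
open Classical in
theorem rep_star (a : LeavittPathAlgebra K G) :
    rep K hB (star a) = (rep K hB a).laurentConjTranspose := by
  induction a using LeavittPathAlgebra.induction with
  | algebraMap k =>
    rw [Algebra.algebraMap_eq_smul_one, star_smul, star_one, map_smul, map_smul, map_one]
    ext x y : 1
    simp only [Matrix.laurentConjTranspose, Matrix.transpose_apply, Matrix.map_apply,
      Matrix.smul_apply]
    simp only [Algebra.smul_def, map_mul, LaurentPolynomial.conj_algebraMap]
    by_cases h : x = y
    · rw [h, Matrix.one_apply_eq, map_one]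
    · rw [Matrix.one_apply_ne h, Matrix.one_apply_ne (Ne.symm h), map_zero]
  | gen x =>
    rcases x with v | e | e
    · rw [star_vert, rep_gen]
      ext x y : 1
      simp only [Matrix.laurentConjTranspose, Matrix.transpose_apply, Matrix.map_apply, repGen,
        Matrix.diagonal_apply]
      by_cases h : x = y
      · subst h
        split_ifs <;> simp
      · rw [if_neg h, if_neg (Ne.symm h), map_zero]
    · rw [star_edge, rep_gen, rep_gen]
      ext y x : 1
      simp only [Matrix.laurentConjTranspose, Matrix.transpose_apply, Matrix.map_apply, repGen,
        Matrix.of_apply]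
      split_ifs <;> simp [conj_weight]
    · rw [star_ghost, rep_gen, rep_gen]
      ext y x : 1
      simp only [Matrix.laurentConjTranspose, Matrix.transpose_apply, Matrix.map_apply, repGen,
        Matrix.of_apply]
      split_ifs <;> simp [conj_weightInv]
  | mul a b ha hb =>
    rw [star_mul, map_mul, map_mul, ha, hb, Matrix.laurentConjTranspose,
      Matrix.laurentConjTranspose, Matrix.laurentConjTranspose, Matrix.map_mul,
      Matrix.transpose_mul]
  | add a b ha hb =>
    rw [star_add, map_add, map_add, ha, hb, Matrix.laurentConjTranspose,
      Matrix.laurentConjTranspose, Matrix.laurentConjTranspose, ← Matrix.transpose_add]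
    congr 1
    ext x y : 1
    simp

end Star

end LeavittPathAlgebra

/-! ### Paths as elements of the algebra, and injectivity of the representation -/

open scoped Matrix

namespace LeavittPathAlgebra

open Leavitt DirectedGraph DirectedGraph.CutPath

section PathElement

variable (K : Type*) [Field K] {V E : Type*} {G : DirectedGraph V E} {B : Set V} [Fintype V]
  [Fintype E]

/-- A path, as an element of the Leavitt path algebra. -/
noncomputable def pathElt (x : G.CutPath B) : LeavittPathAlgebra K G :=
  (x.1.1.map (edge K G)).prod * vert K G x.1.2

variable {K}

theorem pathElt_nil (b : V) (hb : b ∈ B) : pathElt K (nil (G := G) b hb) = vert K G b := by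
  simp [pathElt, nil]

theorem pathElt_cons (e : E) (he : G.source e ∉ B) (y : G.CutPath B) (h : y.src = G.range e) :
    pathElt K (cons e he y h) = edge K G e * pathElt K y := by
  simp [pathElt, cons, mul_assoc]

theorem _root_.DirectedGraph.CutPath.Step.pathElt_eq {e : E} {x y : G.CutPath B} (h : Step e x y)
    (hx : ¬ x.IsNil) : pathElt K x = edge K G e * pathElt K y := by
  rcases h.2 with ⟨_, _, rfl⟩ | ⟨_, rfl⟩
  · exact pathElt_cons _ _ _ _
  · exact absurd rfl hx

theorem pathElt_mul_vert (x : G.CutPath B) : pathElt K x * vert K G x.last = pathElt K x := by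
  rw [pathElt, mul_assoc]
  congr 1
  exact vert_mul_self _

theorem vert_src_mul_pathElt (x : G.CutPath B) : vert K G x.src * pathElt K x = pathElt K x := by
  induction x using CutPath.induction with
  | nil b hb =>
    rw [pathElt_nil]
    exact vert_mul_self b
  | cons e he y h ih =>
    rw [pathElt_cons, ← mul_assoc]
    congr 1
    exact source_mul_edge e

open Classical in
theorem vert_mul_pathElt (v : V) (x : G.CutPath B) :
    vert K G v * pathElt K x = if x.src = v then pathElt K x else 0 := by
  split_ifs with h
  · rw [← h, vert_src_mul_pathElt]
  · rw [← vert_src_mul_pathElt, ← mul_assoc, vert_mul_of_ne (Ne.symm h), zero_mul]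

theorem edge_mul_pathElt_of_ne {e : E} {y : G.CutPath B} (h : y.src ≠ G.range e) :
    edge K G e * pathElt K y = 0 := by
  classical
  rw [← edge_mul_range, mul_assoc, vert_mul_pathElt, if_neg h, mul_zero]

variable [StarRing K]

theorem star_pathElt_mul_pathElt (x : G.CutPath B) :
    star (pathElt K x) * pathElt K x = vert K G x.last := by
  induction x using CutPath.induction with
  | nil b hb =>
    rw [pathElt_nil, star_vert]
    exact vert_mul_self b
  | cons e he y h ih =>
    rw [pathElt_cons, star_mul, star_edge, mul_assoc, ← mul_assoc (ghost K G e),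
      ghost_mul_edge_self, ← h, vert_src_mul_pathElt]
    exact ih

variable (hB : G.IsCut B) [Fintype (G.CutPath B)]
include hB

-- Expand `v` as the sum of all `e e*`, insert the range of `e` in the middle, and repeat until `B`
-- is reached; well-foundedness of the cut ends the process.
open Classical in
theorem sum_pathElt_mul_star (v : V) :
    ∑ x : G.CutPath B with x.src = v, pathElt K x * star (pathElt K x) = vert K G v := by
  induction v using hB.wf.induction with
  | h v ih =>
    by_cases hv : v ∈ B
    · rw [Finset.sum_eq_single (nil v hv), pathElt_nil, star_vert, vert_mul_self]
      · intro x hx hne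
        have hx' := (Finset.mem_filter.1 hx).2
        subst hx'
        exact absurd (eq_nil_of_src_mem hv) hne
      · intro h
        exact (h (Finset.mem_filter.2 ⟨Finset.mem_univ _, rfl⟩)).elim
    · have hv' : ∃ e, G.source e = v := by
        by_contra! h
        exact hv (hB.sink_mem v h)
      rw [vert_eq_sum hv']
      have h1 : ∀ e ∈ Finset.univ.filter fun e => G.source e = v,
          edge K G e * ghost K G e = ∑ y : G.CutPath B with y.src = G.range e,
            edge K G e * pathElt K y * star (edge K G e * pathElt K y) := by
        intro e he
        rw [← edge_mul_range, mul_assoc (edge K G e), range_mul_ghost, edge_mul_range]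
        nth_rw 1 [← edge_mul_range]
        rw [← ih _ ⟨hv, e, (Finset.mem_filter.1 he).2, rfl⟩, Finset.mul_sum, Finset.sum_mul]
        refine Finset.sum_congr rfl fun y _ => ?_
        rw [star_mul, star_edge]
        simp only [mul_assoc]
      rw [Finset.sum_congr rfl h1, Finset.sum_sigma']
      symm
      have hmem : ∀ a ∈ (Finset.univ.filter fun e => G.source e = v).sigma
          (fun e => Finset.univ.filter fun y : G.CutPath B => y.src = G.range e),
          G.source a.1 = v ∧ a.2.src = G.range a.1 := fun a ha =>
        ⟨(Finset.mem_filter.1 (Finset.mem_sigma.1 ha).1).2,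
          (Finset.mem_filter.1 (Finset.mem_sigma.1 ha).2).2⟩
      refine Finset.sum_bij
        (fun a ha => cons a.1 ((hmem a ha).1.symm ▸ hv) a.2 (hmem a ha).2) ?_ ?_ ?_ ?_
      · exact fun a ha => Finset.mem_filter.2 ⟨Finset.mem_univ _, (hmem a ha).1⟩
      · rintro ⟨e, y⟩ ha ⟨e', y'⟩ ha' h
        obtain ⟨rfl, rfl⟩ := Step.right_unique hB
          ⟨(hmem _ ha).2, .inl ⟨(hmem _ ha).1.symm ▸ hv, (hmem _ ha).2, rfl⟩⟩
          ⟨(hmem _ ha').2, .inl ⟨(hmem _ ha').1.symm ▸ hv, (hmem _ ha').2, h⟩⟩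
        rfl
      · intro x hx
        have hx := (Finset.mem_filter.1 hx).2
        induction x using CutPath.induction with
        | nil b hb => exact absurd (hx ▸ hb) hv
        | cons e he y hy _ => exact ⟨⟨e, y⟩, by simpa using ⟨hx, hy⟩, rfl⟩
      · intro a _
        rw [pathElt_cons]

theorem sum_pathElt_mul_star_univ :
    ∑ x : G.CutPath B, pathElt K x * star (pathElt K x) = 1 := by
  classical
  rw [← sum_vert, ← Finset.sum_congr rfl fun v _ => sum_pathElt_mul_star hB v]
  exact (Finset.sum_fiberwise _ _ _).symm

/-- On a cycle there is only one path from the range of `e` to the base, so the preceding sum has a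
single term. -/
theorem pathElt_mul_star_of_step {e : E} {x y : G.CutPath B} (h : Step e x y) (hx : x.IsNil) :
    pathElt K y * star (pathElt K y) = vert K G (G.range e) := by
  classical
  rw [← sum_pathElt_mul_star hB, Finset.sum_eq_single y]
  · intro z hz hne
    exact absurd (eq_of_src_eq_range hB (h.mem_iff.2 hx) (Finset.mem_filter.1 hz).2 h.1) hne
  · intro hy
    exact absurd (Finset.mem_filter.2 ⟨Finset.mem_univ y, h.1⟩) hy

/-- The unit by which `T` acts at the last vertex `b` of a path: it is the cycle at `b`, if any. -/
theorem exists_cycle_unit (b : V) : ∃ C : (LeavittPathAlgebra K G)ˣ,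
    ∀ (e : E) (x y : G.CutPath B), Step e x y → x.IsNil → x.last = b →
      pathElt K x * C = edge K G e * pathElt K y ∧
      pathElt K y * (C⁻¹ : (LeavittPathAlgebra K G)ˣ) = ghost K G e * pathElt K x := by
  by_cases hex : ∃ (e : E) (x y : G.CutPath B), Step e x y ∧ x.IsNil ∧ x.last = b
  · obtain ⟨e, x, y, h, hx, rfl⟩ := hex
    set p := vert K G x.last with hp
    set c := edge K G e * pathElt K y with hc
    have hstar : star c = star (pathElt K y) * ghost K G e := by rw [hc, star_mul, star_edge]
    have hyp : pathElt K y * p = pathElt K y := by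
      rw [hp, h.last_eq hB, pathElt_mul_vert]
    have hcp : c * p = c := by rw [hc, mul_assoc, hyp]
    have hpc : p * c = c := by
      rw [hc, hp, ← hx.src_eq, h.src_eq, ← mul_assoc, source_mul_edge]
    have hpp : p * p = p := vert_mul_self _
    have hps : star p = p := star_vert _
    -- Since `e` is the only edge at its source, `e e*` is that whole vertex; so the cycle `c` is
    -- unitary in the corner of `p`.
    have hcs : c * star c = p := by
      have hv : vert K G (G.source e) = edge K G e * ghost K G e := by
        classical
        rw [vert_eq_sum ⟨e, rfl⟩, Finset.sum_eq_single e]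
        · intro f hf hne
          exact absurd (hB.edge_eq e f (h.mem_iff.2 hx) (Finset.mem_filter.1 hf).2) hne
        · simp
      rw [hstar, hc, mul_assoc, ← mul_assoc (pathElt K y), pathElt_mul_star_of_step hB h hx,
        range_mul_ghost, ← hv, ← h.src_eq, hx.src_eq]
    have hsc : star c * c = p := by
      rw [hstar, hc, mul_assoc, ← mul_assoc (ghost K G e), ghost_mul_edge_self, ← h.1,
        vert_src_mul_pathElt, star_pathElt_mul_pathElt, hp, h.last_eq hB]
    have hcsp : star c * p = star c := by
      have := congrArg star hpc
      rwa [star_mul, hps] at this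
    have hpcs : p * star c = star c := by
      have := congrArg star hcp
      rwa [star_mul, hps] at this
    -- Adding `1 - p` turns a unit of the corner into a unit of the algebra.
    let C : (LeavittPathAlgebra K G)ˣ :=
      { val := c + (1 - p)
        inv := star c + (1 - p)
        val_inv := by
          simp only [add_mul, mul_add, mul_sub, sub_mul, mul_one, one_mul, hcs, hcp, hpcs, hpp]
          abel
        inv_val := by
          simp only [add_mul, mul_add, mul_sub, sub_mul, mul_one, one_mul, hsc, hcsp, hpc, hpp]
          abel }
    refine ⟨C, fun e' x' y' h' hx' hl => ?_⟩
    obtain rfl : x' = x := by rw [hx.eq_nil, hx'.eq_nil]; simp only [hl]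
    obtain ⟨rfl, rfl⟩ := Step.right_unique hB h h'
    have hxp : pathElt K x' = p := by
      rw [hx.eq_nil, pathElt_nil]
    constructor
    · change pathElt K x' * (c + (1 - p)) = c
      rw [hxp, mul_add, mul_sub, hpc, hpp]
      simp
    · change pathElt K y * (star c + (1 - p)) = _
      rw [mul_add, mul_sub, hyp, hstar, ← mul_assoc, pathElt_mul_star_of_step hB h hx,
        range_mul_ghost, hxp, hp, ← hx.src_eq, h.src_eq, ghost_mul_source]
      simp
  · exact ⟨1, fun e x y h hx hl => absurd ⟨e, x, y, h, hx, hl⟩ hex⟩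

end PathElement

section Injective

variable {K : Type*} [Field K] {V E : Type*} {G : DirectedGraph V E} {B : Set V} [Fintype V]
  [Fintype E]

/-- The evaluation of Laurent polynomials at a unit. -/
noncomputable def evalUnit (C : (LeavittPathAlgebra K G)ˣ) :
    K[T;T⁻¹] →ₐ[K] LeavittPathAlgebra K G :=
  AddMonoidAlgebra.lift K (LeavittPathAlgebra K G) ℤ
    ((Units.coeHom (LeavittPathAlgebra K G)).comp (zpowersHom (LeavittPathAlgebra K G)ˣ C))

theorem evalUnit_T (C : (LeavittPathAlgebra K G)ˣ) (n : ℤ) :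
    evalUnit C (T n) = (C ^ n : (LeavittPathAlgebra K G)ˣ) := by
  rw [evalUnit, T, AddMonoidAlgebra.lift_single, one_smul]
  rfl

variable [StarRing K] (hB : G.IsCut B) [Fintype (G.CutPath B)]

/-- The combination of paths with the given coefficients, where `T` acts by the units `C`. -/
noncomputable def combination (C : V → (LeavittPathAlgebra K G)ˣ) (m : G.CutPath B → K[T;T⁻¹]) :
    LeavittPathAlgebra K G :=
  ∑ x, pathElt K x * evalUnit (C x.last) (m x)

-- Letting `T` act by the cycle units makes `combination` a map from the representation to the
-- algebra that respects left multiplication. As the elements `x x*` sum to 1, the element `a` can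
-- be rebuilt from its matrix.
include hB in
open Classical in
theorem rep_injective : Function.Injective (rep K hB) := by
  choose C hC using exists_cycle_unit (K := K) hB
  have hedge : ∀ {e : E} {x y : G.CutPath B}, Step e x y →
      pathElt K x * evalUnit (C x.last) (weight K x) = edge K G e * pathElt K y := by
    intro e x y h
    unfold weight
    split_ifs with hx
    · rw [evalUnit_T, zpow_one]
      exact (hC _ e x y h hx rfl).1
    · rw [map_one, mul_one]
      exact h.pathElt_eq hx
  have hghost : ∀ (e : E) (x : G.CutPath B), ghost K G e * pathElt K x =
      ∑ y, if Step e x y then pathElt K y * evalUnit (C x.last) (weightInv K x) else 0 := by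
    intro e x
    by_cases hxe : x.src = G.source e
    · obtain ⟨f, y, hf⟩ := exists_step_of_src_eq hB hxe
      by_cases hfe : e = f
      · subst hfe
        rw [Finset.sum_eq_single y, if_pos hf]
        · unfold weightInv
          split_ifs with hx
          · rw [evalUnit_T, zpow_neg_one]
            exact (hC _ e x y hf hx rfl).2.symm
          · rw [map_one, mul_one, hf.pathElt_eq hx, ← mul_assoc, ghost_mul_edge_self, ← hf.1,
              vert_src_mul_pathElt]
        · intro y' _ hne
          rw [if_neg fun h => hne (Step.right_unique hB h hf).2]
        · simp
      · rw [Finset.sum_eq_zero]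
        · have hx : ¬ x.IsNil := fun hx =>
            hfe (hB.edge_eq f e (hf.mem_iff.2 hx) (hxe.symm.trans hf.src_eq))
          rw [hf.pathElt_eq hx, ← mul_assoc, ghost_mul_edge_of_ne hfe, zero_mul]
        · intro y' _
          rw [if_neg fun h => hfe (Step.right_unique hB h hf).1]
    · rw [Finset.sum_eq_zero, ← ghost_mul_source, mul_assoc, vert_mul_pathElt, if_neg hxe, mul_zero]
      intro y _
      rw [if_neg fun h => hxe h.src_eq]
  -- It suffices to check generators: `hedge` and `hghost` say that an edge or ghost edge multiplies
  -- paths in the algebra as its matrix prescribes.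
  have key : ∀ (a : LeavittPathAlgebra K G) (m : G.CutPath B → K[T;T⁻¹]),
      combination C (rep K hB a *ᵥ m) = a * combination C m := by
    intro a
    induction a using LeavittPathAlgebra.induction with
    | algebraMap k =>
      intro m
      rw [Algebra.algebraMap_eq_smul_one, map_smul, map_one, Matrix.smul_mulVec, Matrix.one_mulVec,
        smul_mul_assoc, one_mul, combination, combination, Finset.smul_sum]
      simp
    | gen g =>
      intro m
      rw [rep_gen]
      unfold combination
      rw [Finset.mul_sum]
      rcases g with v | e | e
      · refine Finset.sum_congr rfl fun x _ => ?_
        rw [← mul_assoc, vert_mul_pathElt, repGen, Matrix.mulVec_diagonal]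
        split_ifs <;> simp
      · have h1 : ∀ x : G.CutPath B,
            pathElt K x * evalUnit (C x.last) ((repGen K B (.edge e) *ᵥ m) x) =
              ∑ y, if Step e x y then edge K G e * (pathElt K y * evalUnit (C y.last) (m y))
                else 0 := by
          intro x
          simp only [Matrix.mulVec, dotProduct, repGen, Matrix.of_apply, map_sum, Finset.mul_sum]
          refine Finset.sum_congr rfl fun y _ => ?_
          split_ifs with h
          · rw [map_mul, ← mul_assoc, hedge h, h.last_eq hB, mul_assoc]
          · simp
        simp only [h1]
        rw [Finset.sum_comm]
        refine Finset.sum_congr rfl fun y _ => ?_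
        by_cases hy : y.src = G.range e
        · obtain ⟨x, hx⟩ := exists_step hy
          rw [Finset.sum_eq_single x, if_pos hx]
          · intro x' _ hne
            rw [if_neg fun h => hne (h.left_unique hx)]
          · simp
        · rw [← mul_assoc, edge_mul_pathElt_of_ne hy, zero_mul]
          exact Finset.sum_eq_zero fun x _ => if_neg fun h => hy h.1
      · have h1 : ∀ y : G.CutPath B,
            pathElt K y * evalUnit (C y.last) ((repGen K B (.ghost e) *ᵥ m) y) =
              ∑ x, (if Step e x y then pathElt K y * evalUnit (C x.last) (weightInv K x)
                else 0) * evalUnit (C x.last) (m x) := by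
          intro y
          simp only [Matrix.mulVec, dotProduct, repGen, Matrix.of_apply, map_sum, Finset.mul_sum]
          refine Finset.sum_congr rfl fun x _ => ?_
          split_ifs with h
          · rw [map_mul, ← mul_assoc, h.last_eq hB]
          · simp
        simp only [h1]
        rw [Finset.sum_comm]
        refine Finset.sum_congr rfl fun x _ => ?_
        rw [← mul_assoc, hghost, Finset.sum_mul]
    | mul a b ha hb =>
      intro m
      rw [map_mul, ← Matrix.mulVec_mulVec, ha, hb, mul_assoc]
    | add a b ha hb =>
      intro m
      rw [map_add, Matrix.add_mulVec, add_mul, ← ha, ← hb]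
      simp [combination, mul_add, Finset.sum_add_distrib]
  have hsingle : ∀ x : G.CutPath B, combination C (Pi.single x 1) = pathElt K x := by
    intro x
    rw [combination, Finset.sum_eq_single x]
    · simp
    · intro y _ hy
      simp [hy]
    · simp
  have hrec : ∀ a : LeavittPathAlgebra K G,
      ∑ x, combination C (rep K hB a *ᵥ Pi.single x 1) * star (pathElt K x) = a := by
    intro a
    simp only [key, hsingle, mul_assoc]
    rw [← Finset.mul_sum, sum_pathElt_mul_star_univ hB, mul_one]
  intro a b hab
  rw [← hrec a, ← hrec b, hab]

end Injective

end LeavittPathAlgebra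

/-! ### The image of the representation -/

namespace LeavittPathAlgebra

open Leavitt DirectedGraph DirectedGraph.CutPath

section Range

variable (K : Type*) [Field K] {V E : Type*} {G : DirectedGraph V E} {B : Set V}

variable (G B) in
/-- The vertex of `B` is a sink. -/
def IsSink (b : B) : Prop := ∀ e, G.source e ≠ b

/-- The last vertex of a path. -/
def lastBase (x : G.CutPath B) : B := ⟨x.last, x.last_mem⟩

open Classical in
theorem repGen_edge_mul_single [Fintype (G.CutPath B)] {e : E} {x y z : G.CutPath B} (h : Step e x y) (r : K[T;T⁻¹]) :
    repGen K B (.edge e) * Matrix.single y z r = Matrix.single x z (weight K x * r) := by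
  ext i j : 1
  by_cases hj : j = z
  · subst hj
    rw [Matrix.mul_single_apply_same, repGen, Matrix.of_apply, Matrix.single_apply]
    by_cases hi : x = i
    · subst hi
      rw [if_pos h, if_pos ⟨rfl, rfl⟩]
    · rw [if_neg fun h' => hi (h.left_unique h'), if_neg fun h' => hi h'.1, zero_mul]
  · rw [Matrix.mul_single_apply_of_ne _ _ _ _ _ hj, Matrix.single_apply_of_col_ne _ _ (Ne.symm hj)]

variable [Fintype V] [Fintype E] (hB : G.IsCut B) [Fintype (G.CutPath B)]
include hB

open Classical in
theorem rep_mem_blockSubalgebra (a : LeavittPathAlgebra K G) :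
    rep K hB a ∈ blockSubalgebra K K[T;T⁻¹] (lastBase (G := G) (B := B)) (IsSink G B) := by
  have hstep : ∀ {e : E} {x y : G.CutPath B}, Step e x y → lastBase x = lastBase y :=
    fun h => Subtype.ext (h.last_eq hB)
  have hnil : ∀ {e : E} {x y : G.CutPath B}, Step e x y → IsSink G B (lastBase x) → ¬ x.IsNil := by
    intro e x y h hs hx
    exact hs e (h.src_eq.symm.trans hx.src_eq)
  induction a using LeavittPathAlgebra.induction with
  | algebraMap k =>
    rw [AlgHom.commutes]
    exact Subalgebra.algebraMap_mem _ k
  | gen g =>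
    rw [rep_gen]
    rcases g with v | e | e
    · refine blockSubalgebra.diagonal_mem fun x _ => ?_
      split_ifs
      · exact Subalgebra.one_mem _
      · exact Subalgebra.zero_mem _
    · refine ⟨fun x y hxy => if_neg fun h => hxy (hstep h), fun x y hx => ?_⟩
      rw [repGen, Matrix.of_apply]
      split_ifs with h
      · rw [weight, if_neg (hnil h hx)]
        exact Subalgebra.one_mem _
      · exact Subalgebra.zero_mem _
    · refine ⟨fun y x hxy => if_neg fun h => hxy (hstep h).symm, fun y x hy => ?_⟩
      rw [repGen, Matrix.of_apply]
      split_ifs with h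
      · rw [weightInv, if_neg (hnil h (hstep h ▸ hy))]
        exact Subalgebra.one_mem _
      · exact Subalgebra.zero_mem _
  | mul a b ha hb =>
    rw [map_mul]
    exact Subalgebra.mul_mem _ ha hb
  | add a b ha hb =>
    rw [map_add]
    exact Subalgebra.add_mem _ ha hb

-- A path acts as a single matrix unit without weight, because it never leaves a vertex of `B`.
open Classical in
theorem rep_pathElt (x : G.CutPath B) :
    rep K hB (pathElt K x) = Matrix.single x (nil x.last x.last_mem) 1 := by
  induction x using CutPath.induction with
  | nil b hb =>
    rw [pathElt_nil, rep_gen]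
    ext i j : 1
    rw [repGen, Matrix.diagonal_apply, Matrix.single_apply]
    by_cases hi : i.src = b
    · subst hi
      have hi := eq_nil_of_src_mem hb
      by_cases hij : i = j
      · rw [if_pos hij, if_pos rfl, if_pos]
        rw [← hij]
        exact ⟨hi.symm, hi.symm⟩
      · rw [if_neg hij, if_neg]
        rintro ⟨h1, h2⟩
        exact hij (hi.trans h2)
    · rw [if_neg hi, ite_self, if_neg]
      rintro ⟨rfl, -⟩
      exact hi rfl
  | cons e he y h ih =>
    have hs : Step e (cons e he y h) y := ⟨h, .inl ⟨he, h, rfl⟩⟩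
    rw [pathElt_cons, map_mul, ih, rep_gen, repGen_edge_mul_single K hs, mul_one, weight,
      if_neg (mt hs.mem_iff.2 he)]
    rfl

variable [StarRing K]

-- At a sink only scalars are needed. At a cycle, one full turn gives `T` in the corner of the base
-- vertex and its star gives `T⁻¹`; these and the scalars generate all Laurent polynomials.
open Classical in
theorem single_nil_mem_range (b : B) (r : K[T;T⁻¹])
    (hr : IsSink G B b → r ∈ (⊥ : Subalgebra K K[T;T⁻¹])) :
    Matrix.single (nil (G := G) b.1 b.2) (nil b.1 b.2) r ∈ (rep K hB).range := by
  have hC : ∀ k : K, Matrix.single (nil (G := G) b.1 b.2) (nil b.1 b.2) (algebraMap K K[T;T⁻¹] k) ∈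
      (rep K hB).range := by
    intro k
    refine ⟨k • pathElt K (nil (G := G) b.1 b.2), ?_⟩
    change rep K hB _ = _
    rw [map_smul, rep_pathElt, Matrix.smul_single, Algebra.algebraMap_eq_smul_one]
    rfl
  by_cases hb : IsSink G B b
  · obtain ⟨k, rfl⟩ := Algebra.mem_bot.1 (hr hb)
    exact hC k
  · obtain ⟨e, he⟩ : ∃ e, G.source e = b := by
      by_contra! h
      exact hb h
    obtain ⟨b, hb'⟩ := b
    change G.source e = b at he
    subst he
    obtain ⟨y, hy⟩ := exists_src_eq hB (G.range e)
    have hs : Step e (nil _ hb') y := ⟨hy, .inr ⟨hb', rfl⟩⟩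
    have hT : Matrix.single (nil (G := G) _ hb') (nil _ hb') (T 1 : K[T;T⁻¹]) ∈
        (rep K hB).range := by
      refine ⟨edge K G e * pathElt K y, ?_⟩
      change rep K hB _ = _
      have hl : nil y.last y.last_mem = nil (G := G) _ hb' := by
        simp only [← hs.last_eq hB]
        rfl
      rw [map_mul, rep_pathElt, rep_gen, repGen_edge_mul_single K hs, hl, weight,
        if_pos (hs.mem_iff.1 hb'), mul_one]
    have hT' : Matrix.single (nil (G := G) _ hb') (nil _ hb') (T (-1) : K[T;T⁻¹]) ∈
        (rep K hB).range := by
      obtain ⟨a, ha⟩ := hT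
      refine ⟨star a, ?_⟩
      change rep K hB a = _ at ha
      change rep K hB _ = _
      rw [rep_star, ha, Matrix.laurentConjTranspose_single, LaurentPolynomial.conj_T]
    induction r using LaurentPolynomial.induction_on with
    | h_C k => exact hC k
    | h_add hp hq =>
      rw [Matrix.single_add]
      exact Subalgebra.add_mem _ (hp fun h => absurd h hb) (hq fun h => absurd h hb)
    | h_C_mul_T n k ih =>
      rw [LaurentPolynomial.T_add, ← mul_assoc,
        ← Matrix.single_mul_single_same (j := nil (G := G) _ hb')]
      exact Subalgebra.mul_mem _ (ih fun h => absurd h hb) hT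
    | h_C_mul_T_Z n k ih =>
      rw [LaurentPolynomial.T_sub, ← mul_assoc,
        ← Matrix.single_mul_single_same (j := nil (G := G) _ hb')]
      exact Subalgebra.mul_mem _ (ih fun h => absurd h hb) hT'

-- An entry at `(x, y)` inside a block is moved there from the diagonal position of the base vertex,
-- by multiplying with the path `x` on the left and with `y*` on the right.
open Classical in
theorem range_rep :
    (rep K hB).range = blockSubalgebra K K[T;T⁻¹] (lastBase (G := G) (B := B)) (IsSink G B) := by
  refine le_antisymm ?_ fun M hM => ?_
  · rintro _ ⟨a, rfl⟩
    exact rep_mem_blockSubalgebra K hB a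
  · rw [Matrix.matrix_eq_sum_single M]
    refine Subalgebra.sum_mem _ fun x _ => Subalgebra.sum_mem _ fun y _ => ?_
    by_cases hxy : lastBase x = lastBase y
    · obtain ⟨a, ha⟩ := single_nil_mem_range K hB (lastBase x) (M x y) (hM.2 x y)
      change rep K hB a = _ at ha
      refine ⟨pathElt K x * a * star (pathElt K y), ?_⟩
      change rep K hB _ = _
      have hl : nil y.last y.last_mem = nil (G := G) x.last x.last_mem := by
        simp only [show y.last = x.last from congrArg Subtype.val hxy.symm]
      rw [map_mul, map_mul, rep_star, rep_pathElt, rep_pathElt, ha,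
        Matrix.laurentConjTranspose_single, map_one, hl]
      change Matrix.single x (nil x.last x.last_mem) 1 *
        Matrix.single (nil x.last x.last_mem) (nil x.last x.last_mem) (M x y) *
        Matrix.single (nil x.last x.last_mem) y 1 = _
      rw [Matrix.single_mul_single_same, Matrix.single_mul_single_same, one_mul, mul_one]
    · rw [hM.1 x y hxy, Matrix.single_zero]
      exact Subalgebra.zero_mem _

end Range

universe u v

/-- The Leavitt path algebra of a finite no-exit graph is an algebra of block diagonal matrices. -/
theorem exists_blockRep (K : Type*) [Field K] [StarRing K] {V : Type u} {E : Type v} [Fintype V]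
    [Fintype E] (G : DirectedGraph V E) (hG : G.IsNoExit) :
    ∃ (X : Type (max u v)) (B : Type u) (_ : Fintype X) (_ : DecidableEq X) (c : X → B) (P : B → Prop)
      (φ : LeavittPathAlgebra K G →ₐ[K] Matrix X X K[T;T⁻¹]),
      Function.Surjective c ∧ Function.Injective φ ∧ φ.range = blockSubalgebra K K[T;T⁻¹] c P ∧
      ∀ a, φ (star a) = (φ a).laurentConjTranspose := by
  classical
  have hB := hG.isCut_baseSet
  have := CutPath.finite hB
  let _ := Fintype.ofFinite (G.CutPath G.baseSet)
  refine ⟨G.CutPath G.baseSet, G.baseSet, inferInstance, inferInstance, lastBase, IsSink G _,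
    rep K hB, fun b => ⟨nil b.1 b.2, rfl⟩, rep_injective hB, range_rep K hB, rep_star K hB⟩

end LeavittPathAlgebra

/-! ### From a ring isomorphism to a `*`-isomorphism -/

/-- A bijection of the index sets that respects the blocks and their types carries one block
algebra onto the other. -/
theorem blockSubalgebra.map_reindex {K R : Type*} [CommRing K] [CommRing R] [Algebra K R]
    {X B X' B' : Type*} [Fintype X] [DecidableEq X] [Fintype X'] [DecidableEq X'] {c : X → B}
    {P : B → Prop} {c' : X' → B'} {P' : B' → Prop} (τ : X ≃ X') (σ : B ≃ B')
    (hτ : ∀ x, c' (τ x) = σ (c x)) (hσ : ∀ b, P b ↔ P' (σ b)) :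
    (blockSubalgebra K R c P).map (Matrix.reindexAlgEquiv K R τ).toAlgHom =
      blockSubalgebra K R c' P' := by
  ext M
  constructor
  · rintro ⟨N, hN, rfl⟩
    refine ⟨fun x y hxy => ?_, fun x y hx => ?_⟩
    · obtain ⟨x, rfl⟩ := τ.surjective x
      obtain ⟨y, rfl⟩ := τ.surjective y
      change N (τ.symm (τ x)) (τ.symm (τ y)) = 0
      rw [τ.symm_apply_apply, τ.symm_apply_apply]
      exact hN.1 x y fun h => hxy (by rw [hτ, hτ, h])
    · obtain ⟨x, rfl⟩ := τ.surjective x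
      obtain ⟨y, rfl⟩ := τ.surjective y
      change N (τ.symm (τ x)) (τ.symm (τ y)) ∈ _
      rw [τ.symm_apply_apply, τ.symm_apply_apply]
      exact hN.2 x y ((hσ _).2 (hτ x ▸ hx))
  · intro hM
    refine ⟨M.submatrix τ τ, ⟨fun x y hxy => ?_, fun x y hx => ?_⟩, ?_⟩
    · exact hM.1 _ _ fun h => hxy (σ.injective (by rw [← hτ, ← hτ, h]))
    · exact hM.2 _ _ (hτ x ▸ (hσ _).1 hx)
    · ext i j
      change M (τ (τ.symm i)) (τ (τ.symm j)) = _
      rw [τ.apply_symm_apply, τ.apply_symm_apply]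

theorem mainTheorem6 {K : Type*} [Field K] [StarRing K]
    {V₁ E₁ V₂ E₂ : Type*} [Fintype V₁] [Fintype E₁] [Fintype V₂] [Fintype E₂]
    (E : DirectedGraph V₁ E₁) (F : DirectedGraph V₂ E₂)
    (hE : E.IsNoExit) (hF : F.IsNoExit) :
    List.TFAE
      [Nonempty (LeavittPathAlgebra K E ≃+* LeavittPathAlgebra K F),
       Nonempty (LeavittPathAlgebra K E ≃ₐ[K] LeavittPathAlgebra K F),
       Nonempty (LeavittPathAlgebra K E ≃⋆ₐ[K] LeavittPathAlgebra K F)] := by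
  classical
  tfae_have 2 → 1 := fun ⟨f⟩ => ⟨f.toRingEquiv⟩
  tfae_have 3 → 2 := fun ⟨f⟩ => ⟨AlgEquiv.ofRingEquiv (f := (f : _ ≃+* _)) fun k => by
    rw [Algebra.algebraMap_eq_smul_one, Algebra.algebraMap_eq_smul_one]
    exact (map_smul f k 1).trans (congrArg (k • ·) (map_one f))⟩
  tfae_have 1 → 3 := by
    rintro ⟨f⟩
    obtain ⟨X, B, _, _, c, P, φ, hc, hφ, hr, hs⟩ := LeavittPathAlgebra.exists_blockRep K E hE
    obtain ⟨X', B', _, _, c', P', φ', hc', hφ', hr', hs'⟩ :=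
      LeavittPathAlgebra.exists_blockRep K F hF
    let e : LeavittPathAlgebra K E ≃ₐ[K] blockSubalgebra K K[T;T⁻¹] c P :=
      (AlgEquiv.ofInjective φ hφ).trans (Subalgebra.equivOfEq _ _ hr)
    let e' : LeavittPathAlgebra K F ≃ₐ[K] blockSubalgebra K K[T;T⁻¹] c' P' :=
      (AlgEquiv.ofInjective φ' hφ').trans (Subalgebra.equivOfEq _ _ hr')
    -- This is the only use of the ring isomorphism `f`; the `*`-isomorphism `g` is built from `τ`
    -- alone.
    obtain ⟨τ, σ, hτ, hσ⟩ := blockSubalgebra.exists_equiv_of_ringEquiv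
      (LaurentPolynomial.exists_ne_zero_not_isUnit K) hc hc'
      ((e.symm.toRingEquiv.trans f).trans e'.toRingEquiv)
    let d : blockSubalgebra K K[T;T⁻¹] c P ≃ₐ[K] blockSubalgebra K K[T;T⁻¹] c' P' :=
      ((Matrix.reindexAlgEquiv K K[T;T⁻¹] τ).subalgebraMap _).trans
        (Subalgebra.equivOfEq _ _ (blockSubalgebra.map_reindex (K := K) τ σ hτ hσ))
    let g : LeavittPathAlgebra K E ≃ₐ[K] LeavittPathAlgebra K F := (e.trans d).trans e'.symm
    have hg : ∀ a, φ' (g a) = Matrix.reindexAlgEquiv K K[T;T⁻¹] τ (φ a) := fun a =>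
      congrArg Subtype.val (e'.apply_symm_apply (d (e a)))
    -- Compatibility with the involutions is tested on matrices, where rows and columns are permuted
    -- alike, so reindexing commutes with the conjugate transpose.
    refine ⟨StarAlgEquiv.ofAlgEquiv g fun a => hφ' ?_⟩
    rw [hg, hs, hs', hg]
    rfl
  tfae_finish
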